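/- Let $(X,d)$ be a compact metric space and let $\mathbb I=\{S_1,\dots,S_N\}$ ($N\ge 1$) be contracting similarities of $X$, so $d(S_i(x),S_i(y))=c_i\,d(x,y)$ for all $x,y \in X$ with $c_i\in(0,1)$. For a compact set $C\subseteq X$ let $F_C$ be the unique non-empty compact set with $F_C=\bigcup_{i=1}^N S_i(F_C)\cup C$; in particular $F_\emptyset$ is the homogeneous attractor of $\mathbb I$. Let $s$ be the similarity dimension, i.e. the solution of $\sum_{i=1}^N c_i^s=1$. Write $\dim_{\rm H}$, $\dim_{\rm P}$, $\underline{\dim}_{\rm B}$, $\overline{\dim}_{\rm B}$ for Hausdorff, packing, lower box and upper box dimension, with values in $[0,\infty]$, and $\dim_{\rm B}$ for the common value of the last two when they agree. The strong open set condition (SOSC) asks for an open set $U$ with $U\cap F_\emptyset\neq\emptyset$ such that the sets $S_i(U)$ are pairwise disjoint subsets of $U$; the condensation open set condition (COSC) asks in addition that $C\subseteq\overline U$ for such a $U$. (1) The lower box dimension of $F_C$ is not in general a function of the numbers $$\underline{\dim}_{\rm B}C,\quad \overline{\dim}_{\rm B}C,\quad \dim_{\rm H}C,\quad \dim_{\rm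 P}C,\quad \dim_{\rm B}F_\emptyset,\quad s,$$ regardless of separation conditions. Precisely: for every integer $n\ge1$ there is no function $f$ such that, for all systems $\mathbb I$ of contracting similarities of $X=[0,1]^n$ (with the Euclidean metric) and all non-empty compact $C\subseteq X$ for which the COSC holds, the sets $S_1(F_C),\dots,S_N(F_C),C$ are pairwise disjoint and $\dim_{\rm B}F_\emptyset$ exists, $$\underline{\dim}_{\rm B}F_C=f\big(\underline{\dim}_{\rm B}C,\ \overline{\dim}_{\rm B}C,\ \dim_{\rm H}C,\ \dim_{\rm P}C,\ \dim_{\rm B}F_\emptyset,\ s\big).$$ (2) In contrast, for every compact metric space $X$, every system $\mathbb I$ of contracting similarities of $X$ and every non-empty compact $C\subseteq X$, $$\dim_{\rm H}F_C=\max\{\dim_{\rm H}F_\emptyset,\dim_{\rm H}C\},\qquad \dim_{\rm P}F_C=\max\{\dim_{\rm P}F_\emptyset,\dim_{\rm P}C\},$$ and likewise $\dim F_C=\max\{\dim F_\emptyset,\dim C\}$ for every countably stable dimension, that is, for every function $\dim$ from the subsets of $X$ to $[0,\infty]$ with $\dim\bigcup_n A_n=\sup_n\dim A_n$ for all sequences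 $(A_n)$ of subsets of $X$ and $\dim S_i(A)=\dim A$ for all $i$ and all $A\subseteq X$; and if $\mathbb I$ satisfies the SOSC, then $$\overline{\dim}_{\rm B}F_C=\max\{\overline{\dim}_{\rm B}F_\emptyset,\overline{\dim}_{\rm B}C\}.$$ -/

import Mathlib

open Set Filter Topology
open scoped ENNReal NNReal

section InhomogeneousSelfSimilarSets

variable {X : Type*} [MetricSpace X]

/-- The covering number `N_δ(A)`: the least number of sets of diameter at most `δ` that cover `A`.
(It is finite for every `δ > 0` when `A` is totally bounded, in particular in a compact space.) -/
noncomputable def coverNum (δ : ℝ) (A : Set X) : ℕ :=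
  sInf {n : ℕ | ∃ U : Fin n → Set X,
    (∀ i, Metric.ediam (U i) ≤ ENNReal.ofReal δ) ∧ A ⊆ ⋃ i, U i}

/-- Lower box dimension, `liminf_{δ → 0+} log N_δ(A) / (- log δ)`, with values in `[0, ∞]`. -/
noncomputable def lowerBoxDim (A : Set X) : ℝ≥0∞ :=
  liminf (fun δ : ℝ => ENNReal.ofReal (Real.log (coverNum δ A) / -Real.log δ)) (𝓝[>] 0)

/-- Upper box dimension, `limsup_{δ → 0+} log N_δ(A) / (- log δ)`, with values in `[0, ∞]`. -/
noncomputable def upperBoxDim (A : Set X) : ℝ≥0∞ :=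
  limsup (fun δ : ℝ => ENNReal.ofReal (Real.log (coverNum δ A) / -Real.log δ)) (𝓝[>] 0)

/-- The box dimension of `A` exists and equals `D`. -/
def HasBoxDim (A : Set X) (D : ℝ≥0∞) : Prop :=
  lowerBoxDim A = D ∧ upperBoxDim A = D

/-- A `δ`-packing of `A`, given by finitely many pairs (centre, radius): pairwise disjoint closed
balls with centres in `A` and radii in `(0, δ]`. -/
def IsPacking (δ : ℝ) (A : Set X) (P : Finset (X × ℝ)) : Prop :=
  (∀ p ∈ P, p.1 ∈ A ∧ 0 < p.2 ∧ p.2 ≤ δ) ∧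
    (P : Set (X × ℝ)).PairwiseDisjoint (fun p => Metric.closedBall p.1 p.2)

/-- The `t`-dimensional packing premeasure: the limit, as `δ` decreases to `0`, of the supremum of
`∑ (2 r)^t` over the `δ`-packings of `A`. -/
noncomputable def packingPremeasure (t : ℝ≥0) (A : Set X) : ℝ≥0∞ :=
  ⨅ (δ : ℝ) (_ : 0 < δ), ⨆ (P : Finset (X × ℝ)) (_ : IsPacking δ A P),
    ∑ p ∈ P, ENNReal.ofReal (2 * p.2) ^ (t : ℝ)

/-- The `t`-dimensional packing measure. -/
noncomputable def packingMeasure (t : ℝ≥0) (A : Set X) : ℝ≥0∞ :=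
  ⨅ (U : ℕ → Set X) (_ : A ⊆ ⋃ n, U n), ∑' n, packingPremeasure t (U n)

/-- Packing dimension: the critical exponent of the packing measures (same pattern as `dimH`). -/
noncomputable def packingDim (A : Set X) : ℝ≥0∞ :=
  ⨆ (t : ℝ≥0) (_ : packingMeasure t A = ∞), (t : ℝ≥0∞)

/-- A dimension function on the subsets of `X` is countably stable if the dimension of a countable
union is the supremum of the dimensions. -/
def IsCountablyStable (dim : Set X → ℝ≥0∞) : Prop :=
  ∀ A : ℕ → Set X, dim (⋃ n, A n) = ⨆ n, dim (A n)

/-- An iterated function system on `X` consisting of `N ≥ 1` contracting similarities, where the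
`i`-th map has Lipschitz constant `ratio i`. -/
structure SimilarityIFS (X : Type*) [MetricSpace X] (N : ℕ) where
  map : Fin N → X → X
  ratio : Fin N → ℝ
  card_pos : 0 < N
  ratio_pos : ∀ i, 0 < ratio i
  ratio_lt_one : ∀ i, ratio i < 1
  dist_map : ∀ i x y, dist (map i x) (map i y) = ratio i * dist x y

namespace SimilarityIFS

variable {N : ℕ}

/-- `F` is the inhomogeneous attractor `F_C` of the system with condensation set `C`: the
non-empty compact set with `F = ⋃ i, S_i(F) ∪ C`. For `C = ∅` it is the homogeneous attractor. -/
def IsAttractor (I : SimilarityIFS X N) (C F : Set X) : Prop :=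
  F.Nonempty ∧ IsCompact F ∧ F = (⋃ i, I.map i '' F) ∪ C

/-- `s` is the similarity dimension: the solution of `∑ Lip(S_i)^s = 1`. -/
def IsSimilarityDim (I : SimilarityIFS X N) (s : ℝ) : Prop :=
  ∑ i, I.ratio i ^ s = 1

/-- `U` is an open set as required in the strong open set condition; `F` is the homogeneous
attractor. -/
def IsStrongOpenSet (I : SimilarityIFS X N) (F U : Set X) : Prop :=
  IsOpen U ∧ (F ∩ U).Nonempty ∧ (∀ i, I.map i '' U ⊆ U) ∧
    Pairwise fun i j => Disjoint (I.map i '' U) (I.map j '' U)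

/-- The strong open set condition; `F` is the homogeneous attractor. -/
def SOSC (I : SimilarityIFS X N) (F : Set X) : Prop :=
  ∃ U, I.IsStrongOpenSet F U

/-- The condensation open set condition; `F` is the homogeneous attractor. -/
def COSC (I : SimilarityIFS X N) (F C : Set X) : Prop :=
  ∃ U, I.IsStrongOpenSet F U ∧ C ⊆ closure U

/-- The sets `S_1(F_C), …, S_N(F_C), C` are pairwise disjoint; here `F = F_C`. -/
def DisjointPieces (I : SimilarityIFS X N) (C F : Set X) : Prop :=
  (Pairwise fun i j => Disjoint (I.map i '' F) (I.map j '' F)) ∧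
    ∀ i, Disjoint (I.map i '' F) C

end SimilarityIFS

end InhomogeneousSelfSimilarSets

/-- The cube `[0,1]^d` in Euclidean space. -/
def unitCube (d : ℕ) : Set (EuclideanSpace ℝ (Fin d)) :=
  {x | ∀ i, x i ∈ Set.Icc (0 : ℝ) 1}

/-! ### Covering numbers under inclusions, unions and similarities. -/

section CoveringNumbers

variable {X Y : Type*} [MetricSpace X] [MetricSpace Y]

/-! Positive half. `F_C` is `F_∅` together with the countably many images of `C` under compositions
of the maps (`IsAttractor.eq_union_copies`), so an invariant countably stable dimension sees only
`F_∅` and `C` (`IsAttractor.dim_eq_max`). Upper box dimension is not countably stable. It is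
controlled by the renewal inequality `N_δ(F_C) ≤ ∑ N_{δ/c_i}(F_C) + N_δ(C)`, which bounds it by
every `t` above the upper box dimension of `C` with `∑ c_i^t < 1` (`IsAttractor.upperBoxDim_le`).
The SOSC guarantees that such `t` may be taken arbitrarily close to the claimed maximum
(`SOSC.le_lowerBoxDim`).

Negative half. Take four maps of ratio `1/16`, so `s = 1/2`, and a countable `C` whose covering
number at scale `16⁻ˣ` is about `4^x`, except for peaks `8^y` at levels `y = R, R², …`. By level `x
= 2y` the peak no longer affects the order of the covering number of `C`, so the lower box dimension
of `C` is `1/2` for every `R ≥ 4`. In `F_C`, however, the peak is carried to every level `x ≥ y` by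
`4^(x-y)` separated copies and leaves `4^(x-y) 8^y = 2^(2x+y)` points. The exponent of `F_C` thus
exceeds `1/2` by about `y/(4x)`, and how small this becomes before the next peak depends on `R`. For
`R = 4` the lower box dimension is at least `9/16` (`le_lowerBoxDim_quarterIFS`), for `R = 64` at
most `35/64` (`lowerBoxDim_quarterIFS_le`), while the six given numbers coincide. -/

theorem coverNum_le_card {ι : Type*} [Fintype ι] {δ : ℝ} {A : Set X} (U : ι → Set X)
    (hU : ∀ i, Metric.ediam (U i) ≤ ENNReal.ofReal δ) (hA : A ⊆ ⋃ i, U i) :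
    coverNum δ A ≤ Fintype.card ι := by
  refine Nat.sInf_le ⟨fun k => U ((Fintype.equivFin ι).symm k), fun k => hU _, ?_⟩
  intro x hx
  obtain ⟨i, hi⟩ := mem_iUnion.1 (hA hx)
  exact mem_iUnion.2 ⟨Fintype.equivFin ι i, by simpa using hi⟩

theorem exists_cover [CompactSpace X] {δ : ℝ} (hδ : 0 < δ) (A : Set X) :
    ∃ U : Fin (coverNum δ A) → Set X,
      (∀ i, Metric.ediam (U i) ≤ ENNReal.ofReal δ) ∧ A ⊆ ⋃ i, U i := by
  refine Nat.sInf_mem (s := {n : ℕ | ∃ U : Fin n → Set X,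
    (∀ i, Metric.ediam (U i) ≤ ENNReal.ofReal δ) ∧ A ⊆ ⋃ i, U i}) ?_
  obtain ⟨t, -, ht, hc⟩ := (isCompact_univ (X := X)).finite_cover_balls (half_pos hδ)
  have := ht.fintype
  refine ⟨Fintype.card t,
    fun k => Metric.ball ((Fintype.equivFin t).symm k : X) (δ / 2), fun k => ?_, ?_⟩
  · refine Metric.ediam_le fun x hx y hy => ?_
    rw [edist_dist]
    refine ENNReal.ofReal_le_ofReal ?_
    have h1 := Metric.mem_ball.1 hx
    have h2 := Metric.mem_ball.1 hy
    linarith [dist_triangle_right x y ((Fintype.equivFin t).symm k : X)]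
  · intro x _
    obtain ⟨y, hy, hxy⟩ := mem_iUnion₂.1 (hc (mem_univ x))
    exact mem_iUnion.2 ⟨Fintype.equivFin t ⟨y, hy⟩, by simpa using hxy⟩

theorem coverNum_mono [CompactSpace X] {δ ε : ℝ} (hδ : 0 < δ) (h : δ ≤ ε) {A B : Set X}
    (hAB : A ⊆ B) : coverNum ε A ≤ coverNum δ B := by
  obtain ⟨U, hU, hB⟩ := exists_cover hδ B
  simpa using coverNum_le_card U (fun i => (hU i).trans (ENNReal.ofReal_le_ofReal h))
    (hAB.trans hB)

theorem coverNum_iUnion_le [CompactSpace X] {ι : Type*} [Fintype ι] {δ : ℝ} (hδ : 0 < δ)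
    (A : ι → Set X) : coverNum δ (⋃ i, A i) ≤ ∑ i, coverNum δ (A i) := by
  choose U hU hA using fun i => exists_cover hδ (A i)
  have := coverNum_le_card (δ := δ) (A := ⋃ i, A i)
    (fun p : (Σ i, Fin (coverNum δ (A i))) => U p.1 p.2) (fun p => hU _ _) (by
      refine iUnion_subset fun i x hx => ?_
      obtain ⟨k, hk⟩ := mem_iUnion.1 (hA i hx)
      exact mem_iUnion.2 ⟨⟨i, k⟩, hk⟩)
  simpa [Fintype.card_sigma] using this

theorem coverNum_union_le [CompactSpace X] {δ : ℝ} (hδ : 0 < δ) (A B : Set X) :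
    coverNum δ (A ∪ B) ≤ coverNum δ A + coverNum δ B := by
  rw [union_eq_iUnion]
  refine (coverNum_iUnion_le hδ _).trans ?_
  simp

theorem coverNum_image_le [CompactSpace X] {f : X → Y} {c δ : ℝ} (hc : 0 < c) (hδ : 0 < δ)
    (hf : ∀ x y, dist (f x) (f y) ≤ c * dist x y) (A : Set X) :
    coverNum δ (f '' A) ≤ coverNum (δ / c) A := by
  obtain ⟨U, hU, hA⟩ := exists_cover (div_pos hδ hc) A
  have := coverNum_le_card (δ := δ) (A := f '' A) (fun k => f '' U k) (fun k => by
      refine Metric.ediam_le ?_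
      rintro _ ⟨x, hx, rfl⟩ _ ⟨y, hy, rfl⟩
      rw [edist_dist]
      refine ENNReal.ofReal_le_ofReal ((hf x y).trans ?_)
      have h := (Metric.edist_le_ediam_of_mem hx hy).trans (hU k)
      rw [edist_dist, ENNReal.ofReal_le_ofReal_iff (div_pos hδ hc).le, le_div_iff₀ hc] at h
      linarith) (by
      rintro _ ⟨x, hx, rfl⟩
      obtain ⟨k, hk⟩ := mem_iUnion.1 (hA hx)
      exact mem_iUnion.2 ⟨k, mem_image_of_mem _ hk⟩)
  simpa using this

theorem coverNum_le_image [CompactSpace Y] {f : X → Y} {c δ : ℝ} (hc : 0 < c) (hδ : 0 < δ)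
    (hf : ∀ x y, c * dist x y ≤ dist (f x) (f y)) (A : Set X) :
    coverNum (δ / c) A ≤ coverNum δ (f '' A) := by
  obtain ⟨U, hU, hA⟩ := exists_cover hδ (f '' A)
  have := coverNum_le_card (δ := δ / c) (A := A) (fun k => f ⁻¹' U k) (fun k => by
      refine Metric.ediam_le fun x hx y hy => ?_
      rw [edist_dist]
      refine ENNReal.ofReal_le_ofReal ?_
      have h := (Metric.edist_le_ediam_of_mem (s := U k) hx hy).trans (hU k)
      rw [edist_dist, ENNReal.ofReal_le_ofReal_iff hδ.le] at h
      rw [le_div_iff₀ hc]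
      linarith [hf x y]) (by
      intro x hx
      obtain ⟨k, hk⟩ := mem_iUnion.1 (hA (mem_image_of_mem f hx))
      exact mem_iUnion.2 ⟨k, hk⟩)
  simpa using this

theorem one_le_coverNum [CompactSpace X] {δ : ℝ} (hδ : 0 < δ) {A : Set X} (hA : A.Nonempty) :
    1 ≤ coverNum δ A := by
  obtain ⟨U, -, hU⟩ := exists_cover hδ A
  obtain ⟨x, hx⟩ := hA
  obtain ⟨k, -⟩ := mem_iUnion.1 (hU hx)
  exact k.pos

/-- A set of diameter at most `δ` meets at most one `A i`, so a cover of `B` splits into disjoint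
families. -/
theorem sum_coverNum_le [CompactSpace X] {ι : Type*} [Fintype ι] {δ : ℝ} (hδ : 0 < δ)
    {A : ι → Set X} {B : Set X} (hAB : ∀ i, A i ⊆ B)
    (hsep : ∀ i j, i ≠ j → ∀ x ∈ A i, ∀ y ∈ A j, δ < dist x y) :
    ∑ i, coverNum δ (A i) ≤ coverNum δ B := by
  classical
  obtain ⟨U, hU, hB⟩ := exists_cover hδ B
  let J : ι → Finset (Fin (coverNum δ B)) :=
    fun i => Finset.univ.filter fun k => (U k ∩ A i).Nonempty
  have hJ : ∀ i, coverNum δ (A i) ≤ (J i).card := fun i => by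
    have := coverNum_le_card (δ := δ) (A := A i) (fun k : J i => U k) (fun k => hU _) (by
      intro x hx
      obtain ⟨k, hk⟩ := mem_iUnion.1 (hB (hAB i hx))
      exact mem_iUnion.2 ⟨⟨k, by simpa [J] using ⟨x, hk, hx⟩⟩, hk⟩)
    simpa using this
  have hd : ((Finset.univ : Finset ι) : Set ι).PairwiseDisjoint J := by
    intro i _ j _ hij
    refine Finset.disjoint_left.2 fun k hi hj => ?_
    simp only [J, Finset.mem_filter, Finset.mem_univ, true_and] at hi hj
    obtain ⟨x, hx, hxA⟩ := hi
    obtain ⟨y, hy, hyA⟩ := hj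
    have h := (Metric.edist_le_ediam_of_mem hx hy).trans (hU k)
    rw [edist_dist, ENNReal.ofReal_le_ofReal_iff hδ.le] at h
    exact absurd (hsep i j hij x hxA y hyA) (not_lt.2 h)
  calc ∑ i, coverNum δ (A i) ≤ ∑ i, (J i).card := Finset.sum_le_sum fun i _ => hJ i
    _ = (Finset.univ.biUnion J).card := (Finset.card_biUnion hd).symm
    _ ≤ (Finset.univ : Finset (Fin (coverNum δ B))).card := Finset.card_le_univ _
    _ = coverNum δ B := by simp

theorem card_le_coverNum [CompactSpace X] {ι : Type*} [Fintype ι] {δ : ℝ} (hδ : 0 < δ)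
    {B : Set X} (x : ι → X) (hx : ∀ i, x i ∈ B) (hsep : ∀ i j, i ≠ j → δ < dist (x i) (x j)) :
    Fintype.card ι ≤ coverNum δ B := by
  have := sum_coverNum_le hδ (A := fun i => {x i}) (B := B)
    (fun i => singleton_subset_iff.2 (hx i)) (by simpa using hsep)
  refine le_trans ?_ this
  rw [← Finset.card_univ, Finset.card_eq_sum_ones]
  exact Finset.sum_le_sum fun i _ => one_le_coverNum hδ (singleton_nonempty _)

end CoveringNumbers

/-! ### Box dimensions from power bounds on covering numbers. -/

section BoxDimensions

variable {X : Type*} [MetricSpace X]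

/-- A constant factor in a covering number becomes the additive term `a / -log δ`, which vanishes in
the limit. -/
theorem tendsto_add_div_neg_log (t a : ℝ) :
    Tendsto (fun δ : ℝ => ENNReal.ofReal (t + a / -Real.log δ)) (𝓝[>] 0)
      (𝓝 (ENNReal.ofReal t)) := by
  refine ENNReal.tendsto_ofReal ?_
  have h : Tendsto (fun δ : ℝ => -Real.log δ) (𝓝[>] 0) atTop :=
    tendsto_neg_atBot_atTop.comp Real.tendsto_log_nhdsGT_zero
  simpa using (h.const_div_atTop a).const_add t

theorem le_log_div_neg_log {K t δ n : ℝ} (hK : 0 < K) (h0 : 0 < δ) (h1 : δ < 1)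
    (h : K * δ ^ (-t) ≤ n) : t + Real.log K / -Real.log δ ≤ Real.log n / -Real.log δ := by
  have hl : 0 < -Real.log δ := neg_pos.2 (Real.log_neg h0 h1)
  have hp : 0 < δ ^ (-t) := Real.rpow_pos_of_pos h0 _
  have := Real.log_le_log (mul_pos hK hp) h
  rw [Real.log_mul hK.ne' hp.ne', Real.log_rpow h0] at this
  rw [le_div_iff₀ hl, add_mul, div_mul_cancel₀ _ hl.ne']
  linarith

theorem log_div_neg_log_le {K t δ n : ℝ} (hK : 1 ≤ K) (ht : 0 ≤ t) (h0 : 0 < δ) (h1 : δ < 1)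
    (hn : 0 ≤ n) (h : n ≤ K * δ ^ (-t)) :
    Real.log n / -Real.log δ ≤ t + Real.log K / -Real.log δ := by
  have hl : 0 < -Real.log δ := neg_pos.2 (Real.log_neg h0 h1)
  have hp : 0 < δ ^ (-t) := Real.rpow_pos_of_pos h0 _
  rw [div_le_iff₀ hl, add_mul, div_mul_cancel₀ _ hl.ne']
  -- A covering number may be `0`, and then `Real.log 0 = 0`; `1 ≤ K` and `0 ≤ t` keep the
  -- right-hand side nonnegative.
  rcases hn.eq_or_lt with rfl | hn
  · rw [Real.log_zero]
    have := Real.log_nonneg hK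
    positivity
  have := Real.log_le_log hn h
  rw [Real.log_mul (by positivity) hp.ne', Real.log_rpow h0] at this
  linarith

theorem eventually_scale : ∀ᶠ δ : ℝ in 𝓝[>] 0, 0 < δ ∧ δ < 1 :=
  Ioo_mem_nhdsGT one_pos

theorem le_lowerBoxDim {A : Set X} {K t : ℝ} (hK : 0 < K)
    (h : ∀ᶠ δ : ℝ in 𝓝[>] 0, K * δ ^ (-t) ≤ coverNum δ A) :
    ENNReal.ofReal t ≤ lowerBoxDim A := by
  rw [← (tendsto_add_div_neg_log t (Real.log K)).liminf_eq]
  refine liminf_le_liminf ?_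
  filter_upwards [h, eventually_scale] with δ h hδ
  exact ENNReal.ofReal_le_ofReal (le_log_div_neg_log hK hδ.1 hδ.2 h)

theorem upperBoxDim_le {A : Set X} {K t : ℝ} (ht : 0 ≤ t)
    (h : ∀ᶠ δ : ℝ in 𝓝[>] 0, coverNum δ A ≤ K * δ ^ (-t)) :
    upperBoxDim A ≤ ENNReal.ofReal t := by
  rw [← (tendsto_add_div_neg_log t (Real.log (max K 1))).limsup_eq]
  refine limsup_le_limsup ?_
  filter_upwards [h, eventually_scale] with δ h hδ
  refine ENNReal.ofReal_le_ofReal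
    (log_div_neg_log_le (le_max_right _ _) ht hδ.1 hδ.2 (Nat.cast_nonneg _) (h.trans ?_))
  have := Real.rpow_pos_of_pos hδ.1 (-t)
  gcongr
  exact le_max_left _ _

theorem le_upperBoxDim {A : Set X} {K t : ℝ} (hK : 0 < K)
    (h : ∃ᶠ δ : ℝ in 𝓝[>] 0, K * δ ^ (-t) ≤ coverNum δ A) :
    ENNReal.ofReal t ≤ upperBoxDim A := by
  refine le_of_forall_lt_imp_le_of_dense fun a ha => ?_
  refine le_limsup_of_frequently_le ?_
  refine (h.and_eventually (((tendsto_add_div_neg_log t (Real.log K)).eventually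
    (lt_mem_nhds ha)).and eventually_scale)).mono ?_
  rintro δ ⟨h, h1, hδ⟩
  exact h1.le.trans (ENNReal.ofReal_le_ofReal (le_log_div_neg_log hK hδ.1 hδ.2 h))

theorem lowerBoxDim_le {A : Set X} {K t : ℝ} (ht : 0 ≤ t)
    (h : ∃ᶠ δ : ℝ in 𝓝[>] 0, coverNum δ A ≤ K * δ ^ (-t)) :
    lowerBoxDim A ≤ ENNReal.ofReal t := by
  refine le_of_forall_gt_imp_ge_of_dense fun a ha => ?_
  refine liminf_le_of_frequently_le ?_
  refine (h.and_eventually (((tendsto_add_div_neg_log t (Real.log (max K 1))).eventually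
    (gt_mem_nhds ha)).and eventually_scale)).mono ?_
  rintro δ ⟨h, h1, hδ⟩
  refine le_trans (ENNReal.ofReal_le_ofReal
    (log_div_neg_log_le (le_max_right K 1) ht hδ.1 hδ.2 (Nat.cast_nonneg _) (h.trans ?_))) h1.le
  have := Real.rpow_pos_of_pos hδ.1 (-t)
  gcongr
  exact le_max_left _ _

theorem eventually_coverNum_le_of_upperBoxDim_lt {A : Set X} {t : ℝ}
    (h : upperBoxDim A < ENNReal.ofReal t) :
    ∀ᶠ δ : ℝ in 𝓝[>] 0, (coverNum δ A : ℝ) ≤ δ ^ (-t) := by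
  filter_upwards [eventually_lt_of_limsup_lt h, eventually_scale] with δ h hδ
  have hl : 0 < -Real.log δ := neg_pos.2 (Real.log_neg hδ.1 hδ.2)
  have := ((ENNReal.ofReal_lt_ofReal_iff' ).1 h).1
  rw [div_lt_iff₀ hl] at this
  rcases (Nat.cast_nonneg (α := ℝ) (coverNum δ A)).eq_or_lt with h0 | h0
  · rw [← h0]
    exact (Real.rpow_pos_of_pos hδ.1 _).le
  refine (Real.log_le_log_iff h0 (Real.rpow_pos_of_pos hδ.1 _)).1 ?_
  rw [Real.log_rpow hδ.1]
  linarith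

theorem lowerBoxDim_le_upperBoxDim (A : Set X) : lowerBoxDim A ≤ upperBoxDim A :=
  liminf_le_limsup

theorem log_coverNum_div_mono [CompactSpace X] {A B : Set X} (h : A ⊆ B) :
    ∀ᶠ δ : ℝ in 𝓝[>] 0, ENNReal.ofReal (Real.log (coverNum δ A) / -Real.log δ) ≤
      ENNReal.ofReal (Real.log (coverNum δ B) / -Real.log δ) := by
  filter_upwards [eventually_scale] with δ hδ
  have hl : 0 < -Real.log δ := neg_pos.2 (Real.log_neg hδ.1 hδ.2)
  have hm := coverNum_mono hδ.1 le_rfl h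
  refine ENNReal.ofReal_le_ofReal ?_
  gcongr ?_ / _
  rcases Nat.eq_zero_or_pos (coverNum δ A) with h0 | h0
  · simpa [h0] using Real.log_natCast_nonneg _
  · exact Real.log_le_log (by exact_mod_cast h0) (by exact_mod_cast hm)

theorem upperBoxDim_mono [CompactSpace X] {A B : Set X} (h : A ⊆ B) :
    upperBoxDim A ≤ upperBoxDim B :=
  limsup_le_limsup (log_coverNum_div_mono h)

/-- A lower bound for covering numbers along a geometric sequence of scales bounds the lower box
dimension from below. -/
theorem le_lowerBoxDim_of_pow {A : Set X} {b K t : ℝ} (hb : 1 < b) (hK : 0 < K) (ht : 0 ≤ t)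
    {n₀ : ℕ} (h : ∀ n ≥ n₀, ∀ δ : ℝ, 0 < δ → δ * b ^ n < 1 → K * (b ^ n) ^ t ≤ coverNum δ A) :
    ENNReal.ofReal t ≤ lowerBoxDim A := by
  have hb0 : 0 < b := one_pos.trans hb
  refine le_lowerBoxDim (K := K / (b ^ 2) ^ t) (by positivity) ?_
  have hs : 0 < (b ^ (n₀ + 1))⁻¹ := by positivity
  filter_upwards [Ioo_mem_nhdsGT hs, eventually_scale] with δ hδ hδ1
  obtain ⟨n, hn1, hn2⟩ := exists_nat_pow_near (one_le_inv₀ hδ.1 |>.2 hδ1.2.le) hb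
  have hn : n₀ + 1 ≤ n := by
    have : b ^ (n₀ + 1) < b ^ (n + 1) := by
      refine lt_trans ?_ hn2
      rw [lt_inv_comm₀ (by positivity) hδ.1]
      exact hδ.2
    have := (pow_lt_pow_iff_right₀ hb).1 this
    omega
  -- One level back, `δ * b ^ k < 1` is strict. As `δ⁻¹ < b ^ (k + 2)`, this costs the factor `(b ^
  -- 2) ^ t`.
  obtain ⟨k, rfl⟩ : ∃ k, n = k + 1 := ⟨n - 1, by omega⟩
  have hk := h k (by omega) δ hδ.1 (by
    have : b ^ k < δ⁻¹ := lt_of_lt_of_le (pow_lt_pow_right₀ hb (by omega)) hn1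
    rw [lt_inv_comm₀ (by positivity) hδ.1] at this
    calc δ * b ^ k < (b ^ k)⁻¹ * b ^ k := by gcongr
      _ = 1 := inv_mul_cancel₀ (by positivity))
  refine le_trans ?_ hk
  rw [div_mul_eq_mul_div, div_le_iff₀ (by positivity), mul_assoc,
    ← Real.mul_rpow (by positivity) (by positivity), Real.rpow_neg hδ.1.le, ← Real.inv_rpow hδ.1.le]
  refine mul_le_mul_of_nonneg_left (Real.rpow_le_rpow (inv_nonneg.2 hδ.1.le)
    (hn2.le.trans (le_of_eq ?_)) ht) hK.le
  ring

/-- An upper bound for covering numbers along a geometric sequence of scales bounds the upper box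
dimension from above. -/
theorem upperBoxDim_le_of_pow [CompactSpace X] {A : Set X} {b K t : ℝ} (hb : 1 < b) (hK : 0 ≤ K)
    (ht : 0 ≤ t) (h : ∀ n : ℕ, coverNum (b ^ n)⁻¹ A ≤ K * (b ^ n) ^ t) :
    upperBoxDim A ≤ ENNReal.ofReal t := by
  have hb0 : 0 < b := one_pos.trans hb
  refine upperBoxDim_le (K := K * b ^ t) ht ?_
  filter_upwards [eventually_scale] with δ hδ
  obtain ⟨n, hn1, hn2⟩ := exists_nat_pow_near (one_le_inv₀ hδ.1 |>.2 hδ.2.le) hb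
  have h1 : coverNum δ A ≤ coverNum (b ^ (n + 1))⁻¹ A :=
    coverNum_mono (by positivity) (inv_le_of_inv_le₀ hδ.1 hn2.le) Subset.rfl
  have h1' : (coverNum δ A : ℝ) ≤ coverNum (b ^ (n + 1))⁻¹ A := by exact_mod_cast h1
  refine h1'.trans ((h (n + 1)).trans ?_)
  rw [mul_assoc, Real.rpow_neg hδ.1.le, ← Real.inv_rpow hδ.1.le,
    ← Real.mul_rpow (by positivity) (by simpa using hδ.1.le)]
  gcongr
  rw [pow_succ, mul_comm]
  gcongr

end BoxDimensions

/-! ### Countable stability and similarity invariance of Hausdorff and packing dimension. -/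

section CountableStability

theorem IsCountablyStable.dim_iUnion {X : Type*} {dim : Set X → ℝ≥0∞} (h : IsCountablyStable dim)
    {ι : Type*} [Countable ι] [Nonempty ι] (A : ι → Set X) :
    dim (⋃ i, A i) = ⨆ i, dim (A i) := by
  obtain ⟨f, hf⟩ := exists_surjective_nat ι
  rw [← hf.iUnion_comp, h, hf.iSup_comp (g := fun i => dim (A i))]

theorem IsCountablyStable.dim_union {X : Type*} {dim : Set X → ℝ≥0∞} (h : IsCountablyStable dim)
    (A B : Set X) : dim (A ∪ B) = max (dim A) (dim B) := by
  rw [union_eq_iUnion, h.dim_iUnion, iSup_bool_eq]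
  rfl

variable {X : Type*} [MetricSpace X]

theorem isCountablyStable_dimH : IsCountablyStable (dimH : Set X → ℝ≥0∞) :=
  fun A => dimH_iUnion A

theorem IsPacking.anti {δ : ℝ} {A B : Set X} (h : A ⊆ B) {P : Finset (X × ℝ)}
    (hP : IsPacking δ A P) : IsPacking δ B P :=
  ⟨fun p hp => ⟨h (hP.1 p hp).1, (hP.1 p hp).2⟩, hP.2⟩

theorem packingPremeasure_mono (t : ℝ≥0) {A B : Set X} (h : A ⊆ B) :
    packingPremeasure t A ≤ packingPremeasure t B :=
  iInf₂_mono fun _ _ => iSup_mono fun _ => iSup_mono' fun hP => ⟨hP.anti h, le_rfl⟩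

theorem packingMeasure_le_tsum (t : ℝ≥0) {A : Set X} (U : ℕ → Set X) (h : A ⊆ ⋃ n, U n) :
    packingMeasure t A ≤ ∑' n, packingPremeasure t (U n) :=
  iInf₂_le U h

theorem packingMeasure_mono (t : ℝ≥0) {A B : Set X} (h : A ⊆ B) :
    packingMeasure t A ≤ packingMeasure t B :=
  iInf_mono fun _ => iInf_mono' fun hU => ⟨h.trans hU, le_rfl⟩

theorem packingDim_mono {A B : Set X} (h : A ⊆ B) : packingDim A ≤ packingDim B :=
  iSup_mono fun t => iSup_mono' fun hA =>
    ⟨top_le_iff.1 (hA.ge.trans (packingMeasure_mono t h)), le_rfl⟩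

/-- For radii at most `δ`, `(2r)^u ≤ (2δ)^(u-t) (2r)^t`, and the first factor tends to `0` with `δ`.
-/
theorem packingPremeasure_eq_zero {t u : ℝ≥0} (htu : t < u) {A : Set X}
    (h : packingPremeasure t A < ∞) : packingPremeasure u A = 0 := by
  simp only [packingPremeasure, iInf_lt_iff] at h
  obtain ⟨δ₀, hδ₀, hM⟩ := h
  set M := ⨆ (P : Finset (X × ℝ)) (_ : IsPacking δ₀ A P),
    ∑ p ∈ P, ENNReal.ofReal (2 * p.2) ^ (t : ℝ) with hMdef
  have htu' : (0 : ℝ) < u - t := sub_pos.2 (by exact_mod_cast htu)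
  have hlim : Tendsto (fun δ : ℝ => ENNReal.ofReal (2 * δ) ^ ((u : ℝ) - t) * M) (𝓝[>] 0) (𝓝 0) := by
    have h1 : Tendsto (fun δ : ℝ => ENNReal.ofReal (2 * δ)) (𝓝[>] 0) (𝓝 0) := by
      have : Tendsto (fun δ : ℝ => 2 * δ) (𝓝[>] 0) (𝓝 (2 * 0)) :=
        (tendsto_id.mono_left nhdsWithin_le_nhds).const_mul 2
      simpa using ENNReal.tendsto_ofReal this
    have h2 := h1.ennrpow_const ((u : ℝ) - t)
    rw [ENNReal.zero_rpow_of_pos htu'] at h2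
    simpa using ENNReal.Tendsto.mul_const h2 (Or.inr hM.ne)
  refine le_antisymm (ge_of_tendsto hlim ?_) bot_le
  filter_upwards [Ioo_mem_nhdsGT hδ₀] with δ hδ
  refine (iInf₂_le δ hδ.1).trans (iSup₂_le fun P hP => ?_)
  have hPM : ∑ p ∈ P, ENNReal.ofReal (2 * p.2) ^ (t : ℝ) ≤ M :=
    le_iSup₂_of_le P ⟨fun p hp => ⟨(hP.1 p hp).1, (hP.1 p hp).2.1,
      (hP.1 p hp).2.2.trans hδ.2.le⟩, hP.2⟩ le_rfl
  refine le_trans ?_ (mul_le_mul_right hPM _)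
  rw [Finset.mul_sum]
  refine Finset.sum_le_sum fun p hp => ?_
  obtain ⟨-, h0, h1⟩ := hP.1 p hp
  have hp0 : ENNReal.ofReal (2 * p.2) ≠ 0 := by simpa using h0
  calc ENNReal.ofReal (2 * p.2) ^ (u : ℝ)
      = ENNReal.ofReal (2 * p.2) ^ ((u : ℝ) - t) * ENNReal.ofReal (2 * p.2) ^ (t : ℝ) := by
        rw [← ENNReal.rpow_add _ _ hp0 ENNReal.ofReal_ne_top, sub_add_cancel]
    _ ≤ _ := by
        gcongr

theorem packingMeasure_iUnion_le (t : ℝ≥0) (A : ℕ → Set X) :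
    packingMeasure t (⋃ n, A n) ≤ ∑' n, packingMeasure t (A n) := by
  refine ENNReal.le_of_forall_pos_le_add fun ε hε hfin => ?_
  obtain ⟨ε', hε', hsum⟩ := ENNReal.exists_pos_sum_of_countable (ENNReal.coe_pos.2 hε).ne' ℕ
  have hn : ∀ n, ∃ U : ℕ → Set X, A n ⊆ ⋃ k, U k ∧
      ∑' k, packingPremeasure t (U k) ≤ packingMeasure t (A n) + ε' n := fun n => by
    have hlt : packingMeasure t (A n) < packingMeasure t (A n) + ε' n :=
      ENNReal.lt_add_right (ne_top_of_le_ne_top hfin.ne (ENNReal.le_tsum n))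
        (ENNReal.coe_pos.2 (hε' n)).ne'
    conv_lhs at hlt => rw [packingMeasure]
    simp only [iInf_lt_iff] at hlt
    obtain ⟨U, hU, h⟩ := hlt
    exact ⟨U, hU, h.le⟩
  choose U hU hle using hn
  have hcov : (⋃ n, A n) ⊆ ⋃ k, U (Nat.unpair k).1 (Nat.unpair k).2 := by
    refine iUnion_subset fun n x hx => ?_
    obtain ⟨k, hk⟩ := mem_iUnion.1 (hU n hx)
    exact mem_iUnion.2 ⟨Nat.pair n k, by simpa using hk⟩
  calc packingMeasure t (⋃ n, A n)
      ≤ ∑' k, packingPremeasure t (U (Nat.unpair k).1 (Nat.unpair k).2) := packingMeasure_le_tsum t _ hcov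
    _ = ∑' p : ℕ × ℕ, packingPremeasure t (U p.1 p.2) :=
        Nat.pairEquiv.symm.tsum_eq (fun p : ℕ × ℕ => packingPremeasure t (U p.1 p.2))
    _ = ∑' n, ∑' k, packingPremeasure t (U n k) := ENNReal.tsum_prod (f := fun n k => packingPremeasure t (U n k))
    _ ≤ ∑' n, (packingMeasure t (A n) + ε' n) := ENNReal.tsum_le_tsum hle
    _ = ∑' n, packingMeasure t (A n) + ∑' n, (ε' n : ℝ≥0∞) := ENNReal.tsum_add
    _ ≤ _ := by gcongr

theorem packingMeasure_eq_zero {t u : ℝ≥0} (htu : t < u) {A : Set X}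
    (h : packingMeasure t A < ∞) : packingMeasure u A = 0 := by
  simp only [packingMeasure, iInf_lt_iff] at h
  obtain ⟨U, hU, h⟩ := h
  refine le_antisymm ((iInf₂_le U hU).trans (le_of_eq ?_)) bot_le
  exact ENNReal.tsum_eq_zero.2 fun n =>
    packingPremeasure_eq_zero htu ((ENNReal.le_tsum n).trans_lt h)

theorem packingMeasure_eq_zero_of_packingDim_lt {t : ℝ≥0} {A : Set X}
    (h : packingDim A < t) : packingMeasure t A = 0 := by
  obtain ⟨u, hu, hut⟩ := ENNReal.lt_iff_exists_nnreal_btwn.1 h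
  refine packingMeasure_eq_zero (ENNReal.coe_lt_coe.1 hut) (lt_top_iff_ne_top.2 fun htop => ?_)
  exact absurd (le_iSup₂_of_le (f := fun (t : ℝ≥0) (_ : packingMeasure t A = ∞) => (t : ℝ≥0∞))
    u htop le_rfl) (not_le.2 hu)

theorem isCountablyStable_packingDim : IsCountablyStable (packingDim : Set X → ℝ≥0∞) := by
  refine fun A => le_antisymm ?_ (iSup_le fun n => packingDim_mono (subset_iUnion A n))
  refine iSup₂_le fun t ht => le_of_not_gt fun hlt => ?_
  have h0 : ∀ n, packingMeasure t (A n) = 0 := fun n =>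
    packingMeasure_eq_zero_of_packingDim_lt ((le_iSup (fun n => packingDim (A n)) n).trans_lt hlt)
  have := packingMeasure_iUnion_le t A
  simp [ht, h0] at this

/-- Since `f` maps the ball of radius `r / c` into the ball of radius `r`, packings of the image
pull back. -/
theorem packingPremeasure_image_le {f : X → X} {c : ℝ} (hc : 0 < c)
    (hf : ∀ x y, dist (f x) (f y) = c * dist x y) (t : ℝ≥0) (A : Set X) :
    packingPremeasure t (f '' A) ≤ ENNReal.ofReal c ^ (t : ℝ) * packingPremeasure t A := by
  have hct : ENNReal.ofReal c ^ (t : ℝ) ≠ ∞ := ENNReal.rpow_ne_top_of_nonneg t.2 ENNReal.ofReal_ne_top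
  have hct0 : ENNReal.ofReal c ^ (t : ℝ) ≠ 0 :=
    (ENNReal.rpow_pos (ENNReal.ofReal_pos.2 hc) ENNReal.ofReal_ne_top).ne'
  classical
  conv_rhs => rw [packingPremeasure]
  simp only [ENNReal.mul_iInf_of_ne hct0 hct]
  refine le_iInf₂ fun δ hδ => (iInf₂_le (c * δ) (by positivity)).trans ?_
  refine iSup₂_le fun P hP => ?_
  have hex : ∀ p : X × ℝ, ∃ y, p ∈ P → y ∈ A ∧ f y = p.1 := fun p => by
    by_cases hp : p ∈ P
    · obtain ⟨y, hy⟩ := (hP.1 p hp).1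
      exact ⟨y, fun _ => hy⟩
    · exact ⟨p.1, fun h => (hp h).elim⟩
  choose g hgP using hex
  have hg : ∀ p ∈ P, g p ∈ A := fun p hp => (hgP p hp).1
  have hgf : ∀ p ∈ P, f (g p) = p.1 := fun p hp => (hgP p hp).2
  let Q : X × ℝ → X × ℝ := fun p => (g p, p.2 / c)
  have hQinj : Set.InjOn Q P := by
    intro p hp q hq h
    have h1 : g p = g q := congrArg Prod.fst h
    have h2 : p.2 / c = q.2 / c := congrArg Prod.snd h
    refine Prod.ext ?_ ?_
    · rw [← hgf p hp, ← hgf q hq, h1]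
    · field_simp at h2
      exact h2
  have hQ : IsPacking δ A (P.image Q) := by
    constructor
    · intro q hq
      obtain ⟨p, hp, rfl⟩ := Finset.mem_image.1 hq
      obtain ⟨-, h0, h1⟩ := hP.1 p hp
      exact ⟨hg p hp, div_pos h0 hc, by rw [div_le_iff₀ hc]; linarith⟩
    · intro q hq q' hq' hne
      obtain ⟨p, hp, rfl⟩ := Finset.mem_image.1 (Finset.mem_coe.1 hq)
      obtain ⟨p', hp', rfl⟩ := Finset.mem_image.1 (Finset.mem_coe.1 hq')
      have hd : Disjoint (Metric.closedBall p.1 p.2) (Metric.closedBall p'.1 p'.2) :=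
        hP.2 hp hp' (fun h => hne (h ▸ rfl))
      refine Set.disjoint_left.2 fun z hz hz' => Set.disjoint_iff.1 hd (show f z ∈ _ from ⟨?_, ?_⟩)
      · rw [Metric.mem_closedBall] at hz ⊢
        rw [← hgf p hp, hf]
        have : dist z (g p) ≤ p.2 / c := hz
        rw [le_div_iff₀ hc] at this
        linarith
      · rw [Metric.mem_closedBall] at hz' ⊢
        rw [← hgf p' hp', hf]
        have : dist z (g p') ≤ p'.2 / c := hz'
        rw [le_div_iff₀ hc] at this
        linarith
  refine le_trans ?_ (mul_le_mul_right (le_iSup₂_of_le (P.image Q) hQ le_rfl) _)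
  rw [Finset.sum_image hQinj, Finset.mul_sum]
  refine Finset.sum_le_sum fun p hp => ?_
  rw [← ENNReal.mul_rpow_of_nonneg _ _ t.coe_nonneg, ← ENNReal.ofReal_mul hc.le]
  refine ENNReal.rpow_le_rpow (ENNReal.ofReal_le_ofReal (le_of_eq ?_)) t.coe_nonneg
  change 2 * p.2 = c * (2 * (p.2 / c))
  field_simp

/-- As `f` need not be onto, disjointness of balls does not push forward. But each radius is smaller
than the distance of the centres, so balls of half the scaled radii around the image points are
disjoint; hence the `2` in the constant. -/
theorem packingPremeasure_le_image {f : X → X} {c : ℝ} (hc : 0 < c)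
    (hf : ∀ x y, dist (f x) (f y) = c * dist x y) (t : ℝ≥0) (A : Set X) :
    packingPremeasure t A ≤ ENNReal.ofReal (2 / c) ^ (t : ℝ) * packingPremeasure t (f '' A) := by
  have hct : ENNReal.ofReal (2 / c) ^ (t : ℝ) ≠ ∞ :=
    ENNReal.rpow_ne_top_of_nonneg t.2 ENNReal.ofReal_ne_top
  have hct0 : ENNReal.ofReal (2 / c) ^ (t : ℝ) ≠ 0 :=
    (ENNReal.rpow_pos (ENNReal.ofReal_pos.2 (by positivity)) ENNReal.ofReal_ne_top).ne'
  classical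
  conv_rhs => rw [packingPremeasure]
  simp only [ENNReal.mul_iInf_of_ne hct0 hct]
  refine le_iInf₂ fun δ hδ => (iInf₂_le (2 * δ / c) (by positivity)).trans ?_
  refine iSup₂_le fun P hP => ?_
  have hinj : Function.Injective f := fun x y h => by
    have := hf x y
    rw [h, dist_self, eq_comm, mul_eq_zero] at this
    exact dist_eq_zero.1 (this.resolve_left hc.ne')
  let Q : X × ℝ → X × ℝ := fun p => (f p.1, c * p.2 / 2)
  have hQinj : Set.InjOn Q P := by
    intro p hp q hq h
    have h1 : f p.1 = f q.1 := congrArg Prod.fst h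
    have h2 : c * p.2 / 2 = c * q.2 / 2 := congrArg Prod.snd h
    refine Prod.ext (hinj h1) ?_
    field_simp at h2
    exact h2
  have hQ : IsPacking δ (f '' A) (P.image Q) := by
    constructor
    · intro q hq
      obtain ⟨p, hp, rfl⟩ := Finset.mem_image.1 hq
      obtain ⟨hA, h0, h1⟩ := hP.1 p hp
      refine ⟨mem_image_of_mem f hA, by positivity, ?_⟩
      rw [le_div_iff₀ hc] at h1
      simp only [Q]
      linarith
    · intro q hq q' hq' hne
      obtain ⟨p, hp, rfl⟩ := Finset.mem_image.1 (Finset.mem_coe.1 hq)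
      obtain ⟨p', hp', rfl⟩ := Finset.mem_image.1 (Finset.mem_coe.1 hq')
      have hd : Disjoint (Metric.closedBall p.1 p.2) (Metric.closedBall p'.1 p'.2) :=
        hP.2 hp hp' (fun h => hne (h ▸ rfl))
      have hp1 : p.2 < dist p.1 p'.1 := not_le.1 fun h =>
        Set.disjoint_left.1 hd (Metric.mem_closedBall'.2 h)
          (Metric.mem_closedBall_self (hP.1 p' hp').2.1.le)
      have hp2 : p'.2 < dist p.1 p'.1 := not_le.1 fun h =>
        Set.disjoint_left.1 hd (Metric.mem_closedBall_self (hP.1 p hp).2.1.le)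
          (Metric.mem_closedBall.2 h)
      refine Metric.closedBall_disjoint_closedBall ?_
      simp only [Q, hf]
      nlinarith
  refine le_trans ?_ (mul_le_mul_right (le_iSup₂_of_le (P.image Q) hQ le_rfl) _)
  rw [Finset.sum_image hQinj, Finset.mul_sum]
  refine Finset.sum_le_sum fun p hp => ?_
  rw [← ENNReal.mul_rpow_of_nonneg _ _ t.coe_nonneg, ← ENNReal.ofReal_mul (by positivity)]
  refine ENNReal.rpow_le_rpow (ENNReal.ofReal_le_ofReal (le_of_eq ?_)) t.coe_nonneg
  change 2 * p.2 = 2 / c * (2 * (c * p.2 / 2))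
  field_simp

theorem packingMeasure_image_le {f : X → X} {c : ℝ} (hc : 0 < c)
    (hf : ∀ x y, dist (f x) (f y) = c * dist x y) (t : ℝ≥0) (A : Set X) :
    packingMeasure t (f '' A) ≤ ENNReal.ofReal c ^ (t : ℝ) * packingMeasure t A := by
  have hct : ENNReal.ofReal c ^ (t : ℝ) ≠ ∞ := ENNReal.rpow_ne_top_of_nonneg t.2 ENNReal.ofReal_ne_top
  have hct0 : ENNReal.ofReal c ^ (t : ℝ) ≠ 0 :=
    (ENNReal.rpow_pos (ENNReal.ofReal_pos.2 hc) ENNReal.ofReal_ne_top).ne'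
  conv_rhs => rw [packingMeasure]
  simp only [ENNReal.mul_iInf_of_ne hct0 hct]
  refine le_iInf₂ fun U hU => (iInf₂_le (fun n => f '' U n) ?_).trans ?_
  · rw [← image_iUnion]
    exact image_mono hU
  · rw [← ENNReal.tsum_mul_left]
    exact ENNReal.tsum_le_tsum fun n => packingPremeasure_image_le hc hf t _

theorem packingMeasure_le_image {f : X → X} {c : ℝ} (hc : 0 < c)
    (hf : ∀ x y, dist (f x) (f y) = c * dist x y) (t : ℝ≥0) (A : Set X) :
    packingMeasure t A ≤ ENNReal.ofReal (2 / c) ^ (t : ℝ) * packingMeasure t (f '' A) := by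
  have hct : ENNReal.ofReal (2 / c) ^ (t : ℝ) ≠ ∞ :=
    ENNReal.rpow_ne_top_of_nonneg t.2 ENNReal.ofReal_ne_top
  have hct0 : ENNReal.ofReal (2 / c) ^ (t : ℝ) ≠ 0 :=
    (ENNReal.rpow_pos (ENNReal.ofReal_pos.2 (by positivity)) ENNReal.ofReal_ne_top).ne'
  conv_rhs => rw [packingMeasure]
  simp only [ENNReal.mul_iInf_of_ne hct0 hct]
  refine le_iInf₂ fun U hU => (iInf₂_le (fun n => f ⁻¹' U n) ?_).trans ?_
  · rw [← preimage_iUnion]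
    exact image_subset_iff.1 hU
  · rw [← ENNReal.tsum_mul_left]
    exact ENNReal.tsum_le_tsum fun n => (packingPremeasure_le_image hc hf t _).trans
      (mul_le_mul_right (packingPremeasure_mono t (image_preimage_subset f _)) _)

theorem packingDim_image {f : X → X} {c : ℝ} (hc : 0 < c)
    (hf : ∀ x y, dist (f x) (f y) = c * dist x y) (A : Set X) :
    packingDim (f '' A) = packingDim A := by
  refine iSup_congr fun t => iSup_congr_Prop ?_ fun _ => rfl
  constructor <;> intro h
  · by_contra hA
    refine ENNReal.mul_ne_top (ENNReal.rpow_ne_top_of_nonneg t.2 ENNReal.ofReal_ne_top) hA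
      (top_le_iff.1 (h.ge.trans (packingMeasure_image_le hc hf t A)))
  · by_contra hA
    refine ENNReal.mul_ne_top (ENNReal.rpow_ne_top_of_nonneg t.2 ENNReal.ofReal_ne_top) hA
      (top_le_iff.1 (h.ge.trans (packingMeasure_le_image hc hf t A)))

theorem dimH_image_of_dist {f : X → X} {c : ℝ} (hc : 0 < c)
    (hf : ∀ x y, dist (f x) (f y) = c * dist x y) (A : Set X) : dimH (f '' A) = dimH A := by
  refine le_antisymm ?_ ?_
  · exact (LipschitzWith.of_dist_le_mul (K := c.toNNReal) fun x y => by
      rw [hf, Real.coe_toNNReal _ hc.le]).dimH_image_le A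
  · exact (AntilipschitzWith.of_le_mul_dist (K := c⁻¹.toNNReal) fun x y => by
      rw [hf, Real.coe_toNNReal _ (by positivity), inv_mul_cancel_left₀ hc.ne']).le_dimH_image A

/-- Concentric balls intersect, so a packing of a point has at most one ball and the premeasure of
exponent `0` is finite. -/
theorem packingDim_singleton (x : X) : packingDim ({x} : Set X) = 0 := by
  refine le_antisymm (iSup₂_le fun t ht => le_of_not_gt fun h0 => ?_) bot_le
  have h0' : 0 < t := by exact_mod_cast h0
  have hpre : packingPremeasure 0 ({x} : Set X) ≤ 1 := by
    refine (iInf₂_le 1 one_pos).trans (iSup₂_le fun P hP => ?_)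
    have hcard : P.card ≤ 1 := Finset.card_le_one.2 fun p hp q hq => by
      by_contra hne
      have hd : Disjoint (Metric.closedBall p.1 p.2) (Metric.closedBall q.1 q.2) :=
        hP.2 hp hq hne
      refine Set.disjoint_iff.1 hd (show x ∈ _ from ⟨?_, ?_⟩)
      · rw [← show p.1 = x from (hP.1 p hp).1]
        exact Metric.mem_closedBall_self (hP.1 p hp).2.1.le
      · rw [← show q.1 = x from (hP.1 q hq).1]
        exact Metric.mem_closedBall_self (hP.1 q hq).2.1.le
    simpa using (by exact_mod_cast hcard : (P.card : ℝ≥0∞) ≤ 1)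
  have hm : packingMeasure t ({x} : Set X) ≤ ∑' _ : ℕ, packingPremeasure t ({x} : Set X) :=
    packingMeasure_le_tsum t (fun _ => {x}) (subset_iUnion_of_subset 0 Subset.rfl)
  rw [packingPremeasure_eq_zero h0' (hpre.trans_lt ENNReal.one_lt_top), ht] at hm
  simp at hm

theorem packingDim_of_countable {A : Set X} (hA : A.Countable) : packingDim A = 0 := by
  rcases A.eq_empty_or_nonempty with rfl | hne
  · refine le_antisymm (iSup₂_le fun t ht => ?_) bot_le
    have hm : packingMeasure t (∅ : Set X) ≤ ∑' _ : ℕ, packingPremeasure t (∅ : Set X) :=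
      packingMeasure_le_tsum t (fun _ => ∅) (empty_subset _)
    have h0 : packingPremeasure t (∅ : Set X) = 0 := by
      refine le_antisymm ((iInf₂_le 1 one_pos).trans (iSup₂_le fun P hP => ?_)) bot_le
      rw [Finset.sum_eq_zero]
      exact fun p hp => (hP.1 p hp).1.elim
    rw [h0, ht] at hm
    simp at hm
  · have := hne.to_subtype
    have := hA.to_subtype
    conv_lhs => rw [← iUnion_of_singleton_coe A]
    rw [isCountablyStable_packingDim.dim_iUnion]
    simp [packingDim_singleton]

end CountableStability

/-! ### Structure and dimensions of inhomogeneous attractors. -/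

section SelfSimilarDimensions

variable {X : Type*} [MetricSpace X]

/-- If finitely many similarities of ratios `r k` map the compact set `K` to pairwise disjoint
subsets of `K` and `∑ r k ^ t ≥ 1`, then `t` is at most the lower box dimension of `K`. -/
theorem le_lowerBoxDim_of_disjoint_copies [CompactSpace X] {ι : Type*} [Fintype ι] {K : Set X}
    (hK : IsCompact K) (hne : K.Nonempty) {g : ι → X → X} {r : ι → ℝ} {θ t : ℝ} (hθ : θ < 1)
    (hr0 : ∀ k, 0 < r k) (hrθ : ∀ k, r k ≤ θ)
    (hg : ∀ k x y, dist (g k x) (g k y) = r k * dist x y) (hgK : ∀ k, g k '' K ⊆ K)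
    (hdisj : Pairwise fun k l => Disjoint (g k '' K) (g l '' K)) (ht : 0 ≤ t)
    (hsum : 1 ≤ ∑ k, r k ^ t) : ENNReal.ofReal t ≤ lowerBoxDim K := by
  have hcg : ∀ k, Continuous (g k) := fun k =>
    (LipschitzWith.of_dist_le_mul (K := (r k).toNNReal) fun x y => by
      rw [hg, Real.coe_toNNReal _ (hr0 k).le]).continuous
  -- Disjoint compact sets lie at positive distance, and there are finitely many pairs.
  have hsep : ∀ᶠ η : ℝ in 𝓝[>] 0, ∀ k l, k ≠ l →
      ∀ x ∈ g k '' K, ∀ y ∈ g l '' K, η < dist x y := by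
    rw [eventually_all]
    intro k
    rw [eventually_all]
    intro l
    by_cases hkl : k = l
    · simp [hkl]
    obtain ⟨ρ, hρ, h⟩ := Metric.exists_pos_forall_lt_edist (hK.image (hcg k))
      (hK.image (hcg l)).isClosed (hdisj hkl)
    filter_upwards [Ioo_mem_nhdsGT (NNReal.coe_pos.2 hρ)] with η hη _ x hx y hy
    refine hη.2.trans ?_
    have := h x hx y hy
    rwa [edist_nndist, ENNReal.coe_lt_coe, ← NNReal.coe_lt_coe, coe_nndist] at this
  obtain ⟨η, hηsep, hη0, hη1⟩ := (hsep.and eventually_scale).exists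
  have hne' : Nonempty ι := by
    by_contra h
    rw [not_nonempty_iff] at h
    simp at hsum
    linarith
  have hθ0 : 0 < θ := (hr0 (Classical.arbitrary ι)).trans_le (hrθ _)
  -- Below `η` the covering numbers of the copies add up. The copy `k` at scale `δ` is `K` at the
  -- coarser scale `δ / r k ≥ δ / θ`, and `∑ r k ^ t ≥ 1` reproduces the bound.
  have key : ∀ n : ℕ, ∀ δ : ℝ, 0 < δ → η * θ ^ n ≤ δ → η ^ t * δ ^ (-t) ≤ coverNum δ K := by
    intro n
    have hbase : ∀ δ : ℝ, 0 < δ → η ≤ δ → η ^ t * δ ^ (-t) ≤ coverNum δ K := fun δ h0 h => by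
      refine le_trans (b := 1) ?_ (by exact_mod_cast one_le_coverNum h0 hne)
      rw [Real.rpow_neg h0.le, ← div_eq_mul_inv]
      exact div_le_one_of_le₀ (Real.rpow_le_rpow hη0.le h ht) (Real.rpow_nonneg h0.le _)
    induction n with
    | zero => simpa using hbase
    | succ n ih =>
      intro δ h0 h
      rcases le_or_gt η δ with h1 | h1
      · exact hbase δ h0 h1
      have h2 : ∀ k, η ^ t * (δ / r k) ^ (-t) ≤ coverNum δ (g k '' K) := fun k => by
        have h3 := ih (δ / r k) (div_pos h0 (hr0 k)) (by
          rw [le_div_iff₀ (hr0 k)]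
          refine le_trans ?_ h
          rw [pow_succ, ← mul_assoc]
          exact mul_le_mul_of_nonneg_left (hrθ k) (by positivity))
        refine h3.trans ?_
        exact_mod_cast coverNum_le_image (hr0 k) h0 (fun x y => (hg k x y).ge) K
      have h4 : ((∑ k, coverNum δ (g k '' K) : ℕ) : ℝ) ≤ coverNum δ K := by
        exact_mod_cast sum_coverNum_le h0 hgK fun k l hkl x hx y hy =>
          h1.trans (hηsep k l hkl x hx y hy)
      refine le_trans ?_ h4
      push_cast
      refine le_trans ?_ (Finset.sum_le_sum fun k _ => h2 k)
      have h5 : ∀ k, η ^ t * (δ / r k) ^ (-t) = η ^ t * δ ^ (-t) * r k ^ t := fun k => by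
        rw [Real.div_rpow h0.le (hr0 k).le, Real.rpow_neg (hr0 k).le, div_inv_eq_mul]
        ring
      simp only [h5, ← Finset.mul_sum]
      have : 0 ≤ η ^ t * δ ^ (-t) := by positivity
      nlinarith
  refine le_lowerBoxDim (Real.rpow_pos_of_pos hη0 t) ?_
  filter_upwards [eventually_scale] with δ hδ
  obtain ⟨n, hn⟩ := exists_pow_lt_of_lt_one (div_pos hδ.1 hη0) hθ
  refine key n δ hδ.1 ?_
  rw [lt_div_iff₀ hη0] at hn
  linarith

namespace SimilarityIFS

variable {N : ℕ} (I : SimilarityIFS X N)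

theorem continuous_map (i : Fin N) : Continuous (I.map i) :=
  (LipschitzWith.of_dist_le_mul (K := (I.ratio i).toNNReal) fun x y => by
    rw [I.dist_map, Real.coe_toNNReal _ (I.ratio_pos i).le]).continuous

theorem injective_map (i : Fin N) : Function.Injective (I.map i) := fun x y h => by
  have := I.dist_map i x y
  rw [h, dist_self, eq_comm, mul_eq_zero] at this
  exact dist_eq_zero.1 (this.resolve_left (I.ratio_pos i).ne')

theorem nonempty_index (I : SimilarityIFS X N) : Nonempty (Fin N) := ⟨⟨0, I.card_pos⟩⟩

theorem exists_ratio_le : ∃ θ : ℝ, 0 < θ ∧ θ < 1 ∧ ∀ i, I.ratio i ≤ θ := by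
  have := I.nonempty_index
  obtain ⟨i, hi⟩ := Finite.exists_max I.ratio
  exact ⟨I.ratio i, I.ratio_pos i, I.ratio_lt_one i, hi⟩

theorem exists_le_ratio : ∃ c : ℝ, 0 < c ∧ c < 1 ∧ ∀ i, c ≤ I.ratio i := by
  have := I.nonempty_index
  obtain ⟨i, hi⟩ := Finite.exists_min I.ratio
  exact ⟨I.ratio i, I.ratio_pos i, I.ratio_lt_one i, hi⟩

/-- The `n`-th generation of copies of the condensation set. -/
def copies (C : Set X) : ℕ → Set X
  | 0 => C
  | n + 1 => ⋃ i, I.map i '' copies C n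

variable {I} {C F F₀ : Set X}

theorem IsAttractor.image_subset (h : I.IsAttractor C F) (i : Fin N) : I.map i '' F ⊆ F := by
  conv_rhs => rw [h.2.2]
  exact subset_union_of_subset_left (subset_iUnion (fun i => I.map i '' F) i) _

theorem IsAttractor.condensation_subset (h : I.IsAttractor C F) : C ⊆ F := by
  rw [h.2.2]
  exact subset_union_right

theorem IsAttractor.copies_subset (h : I.IsAttractor C F) (n : ℕ) : I.copies C n ⊆ F := by
  induction n with
  | zero => exact h.condensation_subset
  | succ n ih => exact iUnion_subset fun i => (image_mono ih).trans (h.image_subset i)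

theorem copies_empty (n : ℕ) : I.copies ∅ n = ∅ := by
  induction n with
  | zero => rfl
  | succ n ih => simp [copies, ih]

/-- Every point of an inhomogeneous attractor lies in a copy of the condensation set or in the
image of the attractor under compositions of maps of any given length. -/
theorem IsAttractor.mem_copies_or (h : I.IsAttractor C F) {θ : ℝ}
    (hθ : ∀ i, I.ratio i ≤ θ) (n : ℕ) :
    ∀ x ∈ F, (∃ k, x ∈ I.copies C k) ∨ ∃ (f : X → X) (ρ : ℝ), 0 < ρ ∧ ρ ≤ θ ^ n ∧
      (∀ x y, dist (f x) (f y) = ρ * dist x y) ∧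
      (∀ A, (∀ i, I.map i '' A ⊆ A) → f '' A ⊆ A) ∧ x ∈ f '' F := by
  induction n with
  | zero =>
    exact fun x hx => Or.inr ⟨id, 1, one_pos, by simp, by simp, by simp, x, hx, rfl⟩
  | succ n ih =>
    intro x hx
    rw [h.2.2] at hx
    rcases hx with hx | hx
    · obtain ⟨i, y, hy, rfl⟩ := mem_iUnion.1 hx
      rcases ih y hy with ⟨k, hk⟩ | ⟨f, ρ, hρ0, hρ, hf, hA, z, hz, rfl⟩
      · exact Or.inl ⟨k + 1, mem_iUnion.2 ⟨i, y, hk, rfl⟩⟩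
      · refine Or.inr ⟨I.map i ∘ f, I.ratio i * ρ, mul_pos (I.ratio_pos i) hρ0, ?_, fun x y => ?_,
          fun A h => ?_, z, hz, rfl⟩
        · rw [pow_succ']
          exact mul_le_mul (hθ i) hρ hρ0.le ((I.ratio_pos i).le.trans (hθ i))
        · rw [Function.comp_apply, Function.comp_apply, I.dist_map, hf, mul_assoc]
        · rw [image_comp]
          exact (image_mono (hA A h)).trans (h i)
    · exact Or.inl ⟨0, hx⟩

theorem IsAttractor.exists_image (h : I.IsAttractor ∅ F) {θ : ℝ} (hθ : ∀ i, I.ratio i ≤ θ)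
    (n : ℕ) {x : X} (hx : x ∈ F) : ∃ (f : X → X) (ρ : ℝ), 0 < ρ ∧ ρ ≤ θ ^ n ∧
      (∀ x y, dist (f x) (f y) = ρ * dist x y) ∧
      (∀ A, (∀ i, I.map i '' A ⊆ A) → f '' A ⊆ A) ∧ x ∈ f '' F := by
  rcases h.mem_copies_or hθ n x hx with ⟨k, hk⟩ | h
  · rw [copies_empty] at hk
    exact hk.elim
  · exact h

/-- If `x = f y`, then `f a` with `a ∈ A` is a point of `A` within `θ ^ n` times the diameter of the
space from `x`. -/
theorem mem_of_forall_mem_image [CompactSpace X] {A B : Set X} (hA : IsClosed A)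
    (hne : A.Nonempty) {θ : ℝ} (hθ0 : 0 < θ) (hθ1 : θ < 1) {x : X}
    (h : ∀ n : ℕ, ∃ (f : X → X) (ρ : ℝ), 0 < ρ ∧ ρ ≤ θ ^ n ∧
      (∀ x y, dist (f x) (f y) = ρ * dist x y) ∧ f '' A ⊆ A ∧ x ∈ f '' B) : x ∈ A := by
  obtain ⟨a, ha⟩ := hne
  rw [← hA.closure_eq, Metric.mem_closure_iff]
  intro ε hε
  set D := Metric.diam (univ : Set X) + 1 with hD
  have hD0 : 0 < D := by
    have := Metric.diam_nonneg (s := (univ : Set X))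
    linarith
  obtain ⟨n, hn⟩ := exists_pow_lt_of_lt_one (div_pos hε hD0) hθ1
  obtain ⟨f, ρ, hρ0, hρ, hf, hfA, y, -, rfl⟩ := h n
  refine ⟨f a, hfA (mem_image_of_mem f ha), ?_⟩
  have h1 : dist y a ≤ D := by
    have := Metric.dist_le_diam_of_mem (isCompact_univ (X := X)).isBounded (mem_univ y)
      (mem_univ a)
    linarith
  rw [lt_div_iff₀ hD0] at hn
  calc dist (f y) (f a) = ρ * dist y a := hf y a
    _ ≤ θ ^ n * D := mul_le_mul hρ h1 dist_nonneg (by positivity)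
    _ < ε := hn

theorem IsAttractor.homogeneous_subset [CompactSpace X] (h₀ : I.IsAttractor ∅ F₀)
    (h : I.IsAttractor C F) : F₀ ⊆ F := by
  intro x hx
  obtain ⟨θ, hθ0, hθ1, hθ⟩ := I.exists_ratio_le
  refine mem_of_forall_mem_image (B := F₀) h.2.1.isClosed h.1 hθ0 hθ1 fun n => ?_
  obtain ⟨f, ρ, hρ0, hρ, hf, hA, hx⟩ := h₀.exists_image hθ n hx
  exact ⟨f, ρ, hρ0, hρ, hf, hA F h.image_subset, hx⟩

/-- A point of `F` in no copy of `C` lies in images of `F` under compositions of every length; these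
preserve `F₀`, so the point is a limit of points of `F₀`. -/
theorem IsAttractor.eq_union_copies [CompactSpace X] (h₀ : I.IsAttractor ∅ F₀)
    (h : I.IsAttractor C F) : F = F₀ ∪ ⋃ n, I.copies C n := by
  refine Subset.antisymm (fun x hx => ?_)
    (union_subset (h₀.homogeneous_subset h) (iUnion_subset h.copies_subset))
  by_cases hk : ∃ k, x ∈ I.copies C k
  · exact Or.inr (mem_iUnion.2 hk)
  obtain ⟨θ, hθ0, hθ1, hθ⟩ := I.exists_ratio_le
  refine Or.inl (mem_of_forall_mem_image (B := F) h₀.2.1.isClosed h₀.1 hθ0 hθ1 fun n => ?_)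
  obtain ⟨f, ρ, hρ0, hρ, hf, hA, hx⟩ := (h.mem_copies_or hθ n x hx).resolve_left hk
  exact ⟨f, ρ, hρ0, hρ, hf, hA F₀ h₀.image_subset, hx⟩

theorem IsAttractor.dim_eq_max [CompactSpace X] (h₀ : I.IsAttractor ∅ F₀)
    (h : I.IsAttractor C F) {dim : Set X → ℝ≥0∞} (hdim : IsCountablyStable dim)
    (hmap : ∀ i A, dim (I.map i '' A) = dim A) : dim F = max (dim F₀) (dim C) := by
  have := I.nonempty_index
  have hc : ∀ n, dim (I.copies C n) = dim C := fun n => by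
    induction n with
    | zero => rfl
    | succ n ih => simp only [copies, hdim.dim_iUnion, hmap, ih, ciSup_const]
  rw [h₀.eq_union_copies h, hdim.dim_union, hdim]
  simp only [hc, ciSup_const]

/-- The index type plays the role of the words of length `n`. Invariance is asserted for every `A`
because both the open set and the attractor need it. -/
theorem exists_iterate {U : Set X} (hU : ∀ i, I.map i '' U ⊆ U)
    (hdisj : Pairwise fun i j => Disjoint (I.map i '' U) (I.map j '' U)) (t : ℝ) (n : ℕ) :
    ∃ (ι : Type) (_ : Fintype ι) (g : ι → X → X) (r : ι → ℝ),
      (∀ k, 0 < r k ∧ r k ≤ 1) ∧ (∀ k x y, dist (g k x) (g k y) = r k * dist x y) ∧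
      (∀ k A, (∀ i, I.map i '' A ⊆ A) → g k '' A ⊆ A) ∧
      (Pairwise fun k l => Disjoint (g k '' U) (g l '' U)) ∧
      ∑ k, r k ^ t = (∑ i, I.ratio i ^ t) ^ n := by
  induction n with
  | zero =>
    exact ⟨Unit, inferInstance, fun _ => id, fun _ => 1, by simp, by simp, by simp,
      fun k l h => (h rfl).elim, by simp⟩
  | succ n ih =>
    obtain ⟨ι, _, g, r, hr, hg, hA, hd, hs⟩ := ih
    refine ⟨Fin N × ι, inferInstance, fun p => I.map p.1 ∘ g p.2, fun p => I.ratio p.1 * r p.2,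
      fun p => ⟨mul_pos (I.ratio_pos _) (hr _).1,
        mul_le_one₀ (I.ratio_lt_one _).le (hr _).1.le (hr _).2⟩,
      fun p x y => ?_, fun p A h => ?_, ?_, ?_⟩
    · exact (I.dist_map _ _ _).trans (by rw [hg, mul_assoc])
    · rw [image_comp]
      exact (image_mono (hA _ A h)).trans (h _)
    · rintro ⟨i, k⟩ ⟨j, l⟩ hne
      simp only [image_comp]
      by_cases hij : i = j
      · subst hij
        exact (disjoint_image_iff (I.injective_map i)).2 (hd fun h => hne (by rw [h]))
      · exact (hdisj hij).mono (image_mono (hA _ U hU)) (image_mono (hA _ U hU))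
    · rw [Fintype.sum_prod_type, pow_succ', Finset.sum_mul, ← hs]
      refine Finset.sum_congr rfl fun i _ => ?_
      rw [Finset.mul_sum]
      exact Finset.sum_congr rfl fun k _ => Real.mul_rpow (I.ratio_pos i).le (hr k).1.le

/-- `F₀` need not lie in `U`, but a small copy `f '' F₀` around a point of `F₀ ∩ U` does. Its images
under words of length `m` are disjoint copies of `F₀`, and `ρ^t (∑ c_i^t)^m ≥ 1` for large `m`. -/
theorem SOSC.le_lowerBoxDim [CompactSpace X] (hS : I.SOSC F₀) (h₀ : I.IsAttractor ∅ F₀) {t : ℝ}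
    (ht : 0 ≤ t) (hsum : 1 < ∑ i, I.ratio i ^ t) : ENNReal.ofReal t ≤ lowerBoxDim F₀ := by
  obtain ⟨U, hUo, ⟨x, hxF, hxU⟩, hU, hdisj⟩ := hS
  obtain ⟨θ, hθ0, hθ1, hθ⟩ := I.exists_ratio_le
  obtain ⟨ε, hε, hball⟩ := Metric.isOpen_iff.1 hUo x hxU
  set D := Metric.diam (univ : Set X) + 1 with hD
  have hD0 : 0 < D := by
    have := Metric.diam_nonneg (s := (univ : Set X))
    linarith
  obtain ⟨n, hn⟩ := exists_pow_lt_of_lt_one (div_pos hε hD0) hθ1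
  -- Length `n + 1` rather than `n` gives `ρ ≤ θ` even for `n = 0`.
  obtain ⟨f, ρ, hρ0, hρ, hf, hA, y, hy, rfl⟩ := h₀.exists_image hθ (n + 1) hxF
  have hρθ : ρ ≤ θ := hρ.trans (pow_le_of_le_one hθ0.le hθ1.le n.succ_ne_zero)
  have hfU : f '' F₀ ⊆ U := by
    rintro _ ⟨z, -, rfl⟩
    refine hball (Metric.mem_ball.2 ?_)
    have h1 : dist z y ≤ D := by
      have := Metric.dist_le_diam_of_mem (isCompact_univ (X := X)).isBounded (mem_univ z)
        (mem_univ y)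
      linarith
    rw [lt_div_iff₀ hD0] at hn
    calc dist (f z) (f y) = ρ * dist z y := hf z y
      _ ≤ θ ^ n * D := mul_le_mul (hρ.trans (pow_le_pow_of_le_one hθ0.le hθ1.le n.le_succ)) h1
          dist_nonneg (by positivity)
      _ < ε := hn
  obtain ⟨m, hm⟩ := pow_unbounded_of_one_lt (ρ ^ t)⁻¹ hsum
  obtain ⟨ι, _, g, r, hr, hg, hgA, hd, hs⟩ := exists_iterate hU hdisj t m
  have hFF : f '' F₀ ⊆ F₀ := hA F₀ h₀.image_subset
  refine le_lowerBoxDim_of_disjoint_copies h₀.2.1 h₀.1 (g := fun k => g k ∘ f)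
    (r := fun k => r k * ρ) hθ1 (fun k => mul_pos (hr k).1 hρ0)
    (fun k => (mul_le_of_le_one_left hρ0.le (hr k).2).trans hρθ) (fun k x y => ?_)
    (fun k => ?_) (fun k l hkl => ?_) ht ?_
  · rw [Function.comp_apply, Function.comp_apply, hg, hf, mul_assoc]
  · rw [image_comp]
    exact (image_mono hFF).trans (hgA k F₀ h₀.image_subset)
  · simp only [image_comp]
    exact (hd hkl).mono (image_mono hfU) (image_mono hfU)
  · have hρt : 0 < ρ ^ t := Real.rpow_pos_of_pos hρ0 t
    simp only [Real.mul_rpow (hr _).1.le hρ0.le, ← Finset.sum_mul, hs]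
    rw [← div_le_iff₀ hρt, one_div]
    exact hm.le

theorem IsAttractor.coverNum_le [CompactSpace X] (h : I.IsAttractor C F) {δ : ℝ} (hδ : 0 < δ) :
    coverNum δ F ≤ ∑ i, coverNum (δ / I.ratio i) F + coverNum δ C := by
  conv_lhs => rw [h.2.2]
  refine (coverNum_union_le hδ _ _).trans (Nat.add_le_add_right ?_ _)
  refine (coverNum_iUnion_le hδ _).trans (Finset.sum_le_sum fun i _ => ?_)
  exact coverNum_image_le (I.ratio_pos i) hδ (fun x y => (I.dist_map i x y).le) F

/-- With `q = ∑ c_i^t < 1`, the renewal inequality turns the bound `B δ^(-t)` at the scales `δ /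
c_i` into `(q B + 1) δ^(-t)` at `δ`, which is no worse once `B ≥ 1 / (1 - q)`. -/
theorem IsAttractor.upperBoxDim_le [CompactSpace X] (h : I.IsAttractor C F) {t : ℝ} (ht : 0 ≤ t)
    (hsum : ∑ i, I.ratio i ^ t < 1) (hC : upperBoxDim C < ENNReal.ofReal t) :
    upperBoxDim F ≤ ENNReal.ofReal t := by
  obtain ⟨c, hc0, hc1, hc⟩ := I.exists_le_ratio
  obtain ⟨θ, hθ0, hθ1, hθ⟩ := I.exists_ratio_le
  obtain ⟨δ₀, hδ₀0, hδ₀⟩ := mem_nhdsGT_iff_exists_Ioo_subset.1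
    ((eventually_coverNum_le_of_upperBoxDim_lt hC).and eventually_scale)
  have hδ₀1 : δ₀ ≤ 1 := le_of_forall_lt fun a ha => by
    rcases le_or_gt a 0 with h | h
    · linarith
    · exact (hδ₀ ⟨h, ha⟩).2.2
  rw [mem_Ioi] at hδ₀0
  set q := ∑ i, I.ratio i ^ t with hq
  -- For `δ < δ₁` the estimate for `C` is available and every `δ / c_i` is still at most `1`.
  set δ₁ := c * δ₀ with hδ₁
  have hδ₁0 : 0 < δ₁ := mul_pos hc0 hδ₀0
  have hδ₁₀ : δ₁ < δ₀ := mul_lt_of_lt_one_left hδ₀0 hc1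
  set B := max (coverNum δ₁ F : ℝ) (1 - q)⁻¹ with hB
  have hB0 : 0 ≤ B := le_max_of_le_left (Nat.cast_nonneg _)
  have hqB : q * B + 1 ≤ B := by
    have : (1 - q)⁻¹ ≤ B := le_max_right _ _
    rw [inv_le_iff_one_le_mul₀ (sub_pos.2 hsum)] at this
    linarith
  have key : ∀ n : ℕ, ∀ δ : ℝ, 0 < δ → δ ≤ 1 → δ₁ * θ ^ n ≤ δ →
      (coverNum δ F : ℝ) ≤ B * δ ^ (-t) := by
    intro n
    have hbase : ∀ δ : ℝ, 0 < δ → δ ≤ 1 → δ₁ ≤ δ → (coverNum δ F : ℝ) ≤ B * δ ^ (-t) :=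
      fun δ h0 h1 h2 => by
        have h3 : (coverNum δ F : ℝ) ≤ coverNum δ₁ F := by
          exact_mod_cast coverNum_mono hδ₁0 h2 Subset.rfl
        refine (h3.trans (le_max_left _ _)).trans (le_mul_of_one_le_right hB0 ?_)
        exact Real.one_le_rpow_of_pos_of_le_one_of_nonpos h0 h1 (by linarith)
    induction n with
    | zero => simpa using hbase
    | succ n ih =>
      intro δ h0 h1 h2
      rcases le_or_gt δ₁ δ with h3 | h3
      · exact hbase δ h0 h1 h3
      have h4 : ∀ i, (coverNum (δ / I.ratio i) F : ℝ) ≤ B * δ ^ (-t) * I.ratio i ^ t := fun i => by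
        have hi := I.ratio_pos i
        refine (ih (δ / I.ratio i) (div_pos h0 hi) ?_ ?_).trans (le_of_eq ?_)
        · rw [div_le_one hi]
          refine h3.le.trans (le_trans ?_ (hc i))
          exact mul_le_of_le_one_right hc0.le hδ₀1
        · rw [le_div_iff₀ hi]
          refine le_trans ?_ h2
          rw [pow_succ, ← mul_assoc]
          exact mul_le_mul_of_nonneg_left (hθ i) (by positivity)
        · rw [Real.div_rpow h0.le hi.le, Real.rpow_neg hi.le, div_inv_eq_mul, mul_assoc]
      have h5 : (coverNum δ F : ℝ) ≤
          ∑ i, (coverNum (δ / I.ratio i) F : ℝ) + coverNum δ C := by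
        exact_mod_cast h.coverNum_le h0
      have h6 : (coverNum δ C : ℝ) ≤ δ ^ (-t) := (hδ₀ ⟨h0, h3.trans hδ₁₀⟩).1
      have h7 := Finset.sum_le_sum fun i (_ : i ∈ Finset.univ) => h4 i
      rw [← Finset.mul_sum, ← hq] at h7
      have h8 : 0 < δ ^ (-t) := Real.rpow_pos_of_pos h0 _
      nlinarith
  refine _root_.upperBoxDim_le (K := B) ht ?_
  filter_upwards [eventually_scale] with δ hδ
  obtain ⟨n, hn⟩ := exists_pow_lt_of_lt_one (div_pos hδ.1 hδ₁0) hθ1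
  refine key n δ hδ.1 hδ.2.le ?_
  rw [lt_div_iff₀ hδ₁0] at hn
  linarith

/-- Above the lower box dimension of `F₀` the sum `∑ c_i^r` is at most `1`, so at any larger
exponent it is below `1`. The lower box dimension on the right makes the case `C = ∅` yield
existence of the box dimension of `F₀`. -/
theorem SOSC.upperBoxDim_le [CompactSpace X] (hS : I.SOSC F₀) (h₀ : I.IsAttractor ∅ F₀)
    (h : I.IsAttractor C F) : upperBoxDim F ≤ max (lowerBoxDim F₀) (upperBoxDim C) := by
  refine le_of_not_gt fun hlt => ?_
  obtain ⟨r, hr1, hr2⟩ := ENNReal.lt_iff_exists_nnreal_btwn.1 hlt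
  obtain ⟨u, hu1, hu2⟩ := ENNReal.lt_iff_exists_nnreal_btwn.1 hr2
  rw [max_lt_iff] at hr1
  have hq : ∑ i, I.ratio i ^ (r : ℝ) ≤ 1 := by
    by_contra! hq
    have := hS.le_lowerBoxDim h₀ r.coe_nonneg hq
    rw [ENNReal.ofReal_coe_nnreal] at this
    exact absurd this (not_le.2 hr1.1)
  have := I.nonempty_index
  have hru : (r : ℝ) < u := by exact_mod_cast hu1
  have hq' : ∑ i, I.ratio i ^ (u : ℝ) < 1 := by
    refine lt_of_lt_of_le (Finset.sum_lt_sum_of_nonempty Finset.univ_nonempty fun i _ => ?_) hq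
    exact Real.rpow_lt_rpow_of_exponent_gt (I.ratio_pos i) (I.ratio_lt_one i) hru
  have := h.upperBoxDim_le u.coe_nonneg hq' (by
    rw [ENNReal.ofReal_coe_nnreal]
    exact hr1.2.trans hu1)
  rw [ENNReal.ofReal_coe_nnreal] at this
  exact absurd this (not_le.2 hu2)

theorem upperBoxDim_empty : upperBoxDim (∅ : Set X) = 0 := by
  have h : ∀ δ : ℝ, coverNum δ (∅ : Set X) = 0 := fun δ =>
    Nat.le_zero.1 ((coverNum_le_card (δ := δ) (A := (∅ : Set X)) (fun k : Fin 0 => k.elim0)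
      (fun k => k.elim0) (empty_subset _)).trans (by simp))
  simp [upperBoxDim, h]

theorem SOSC.hasBoxDim [CompactSpace X] (hS : I.SOSC F₀) (h₀ : I.IsAttractor ∅ F₀) :
    HasBoxDim F₀ (lowerBoxDim F₀) := by
  refine ⟨rfl, le_antisymm ?_ (lowerBoxDim_le_upperBoxDim F₀)⟩
  simpa [upperBoxDim_empty] using hS.upperBoxDim_le h₀ h₀

theorem SOSC.upperBoxDim_eq_max [CompactSpace X] (hS : I.SOSC F₀) (h₀ : I.IsAttractor ∅ F₀)
    (h : I.IsAttractor C F) : upperBoxDim F = max (upperBoxDim F₀) (upperBoxDim C) :=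
  le_antisymm
    ((hS.upperBoxDim_le h₀ h).trans (max_le_max_right _ (lowerBoxDim_le_upperBoxDim F₀)))
    (max_le (upperBoxDim_mono (h₀.homogeneous_subset h)) (upperBoxDim_mono h.condensation_subset))

theorem image_map_closure [CompactSpace X] (i : Fin N) (A : Set X) :
    I.map i '' closure A = closure (I.map i '' A) :=
  ((isClosed_closure.isCompact.image (I.continuous_map i)).isClosed.closure_subset_iff.2
    (image_mono subset_closure)).antisymm' (image_closure_subset_closure_image (I.continuous_map i))

/-- The inhomogeneous attractor exists: it is the closure of the union of all copies of the
condensation set. -/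
theorem isAttractor_closure_copies [CompactSpace X] (hC : IsCompact C) (hne : C.Nonempty) :
    I.IsAttractor C (closure (⋃ n, I.copies C n)) := by
  refine ⟨(hne.mono (subset_iUnion (I.copies C) 0)).closure, isClosed_closure.isCompact, ?_⟩
  have h1 : (⋃ n, I.copies C n) = (⋃ i, I.map i '' ⋃ n, I.copies C n) ∪ C := by
    ext x
    simp only [mem_iUnion, mem_union, image_iUnion]
    constructor
    · rintro ⟨n, hn⟩
      cases n with
      | zero => exact Or.inr hn
      | succ n =>
        obtain ⟨i, hi⟩ := mem_iUnion.1 hn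
        exact Or.inl ⟨i, n, hi⟩
    · rintro (⟨i, n, hi⟩ | hx)
      · exact ⟨n + 1, mem_iUnion.2 ⟨i, hi⟩⟩
      · exact ⟨0, hx⟩
  conv_lhs => rw [h1, closure_union, closure_iUnion_of_finite, hC.isClosed.closure_eq]
  simp only [image_map_closure]

end SimilarityIFS

end SelfSimilarDimensions

/-! ### Four maps of ratio `1/16` on the cube. -/

section Cube

instance compactSpace_unitCube (d : ℕ) : CompactSpace (unitCube d) := by
  rw [← isCompact_iff_compactSpace]
  have h : unitCube d = WithLp.toLp 2 '' (Set.univ.pi fun _ : Fin d => Icc (0 : ℝ) 1) := by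
    ext x
    constructor
    · exact fun hx => ⟨x.ofLp, fun i _ => hx i, rfl⟩
    · rintro ⟨y, hy, rfl⟩ i
      exact hy i (mem_univ i)
  rw [h]
  exact (isCompact_univ_pi fun _ => isCompact_Icc).image (PiLp.continuous_toLp 2 _)

variable {m : ℕ}

theorem abs_sub_apply_le_dist (x y : unitCube (m + 1)) (i : Fin (m + 1)) :
    |x.1 i - y.1 i| ≤ dist x y := by
  rw [Subtype.dist_eq, dist_eq_norm]
  exact PiLp.norm_apply_le (x.1 - y.1) i

/-- The point of the first axis of the cube whose first coordinate is closest to `t`. -/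
noncomputable def axisPoint (m : ℕ) (t : ℝ) : unitCube (m + 1) :=
  ⟨EuclideanSpace.single 0 (projIcc (0 : ℝ) 1 zero_le_one t : ℝ), fun i => by
    rw [PiLp.single_apply]
    split_ifs
    · exact (projIcc (0 : ℝ) 1 zero_le_one t).2
    · simp⟩

theorem axisPoint_apply_zero {t : ℝ} (ht : t ∈ Icc (0 : ℝ) 1) : (axisPoint m t).1 0 = t := by
  simp [axisPoint, projIcc_of_mem zero_le_one ht]

theorem dist_axisPoint_le (s t : ℝ) : dist (axisPoint m s) (axisPoint m t) ≤ |s - t| := by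
  rw [Subtype.dist_eq, axisPoint, axisPoint, PiLp.dist_single_same, ← Real.dist_eq]
  have := (LipschitzWith.projIcc (zero_le_one (α := ℝ))).dist_le_mul s t
  simpa [Subtype.dist_eq] using this

/-- Four contractions of the cube by the factor `1 / 16`, with equally spaced images. -/
noncomputable def quarterIFS (m : ℕ) : SimilarityIFS (unitCube (m + 1)) 4 where
  map i x := ⟨(1 / 16 : ℝ) • x.1 + EuclideanSpace.single 0 ((i : ℕ) / 4 : ℝ), fun j => by
    obtain ⟨h0, h1⟩ := x.2 j
    have hi : ((i : ℕ) : ℝ) ≤ 3 := by exact_mod_cast Nat.le_of_lt_succ i.2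
    have hi0 : (0 : ℝ) ≤ (i : ℕ) := Nat.cast_nonneg _
    rw [PiLp.add_apply, PiLp.smul_apply, PiLp.single_apply, smul_eq_mul]
    split_ifs
    · constructor <;> linarith
    · constructor <;> linarith⟩
  ratio _ := 1 / 16
  card_pos := by norm_num
  ratio_pos _ := by norm_num
  ratio_lt_one _ := by norm_num
  dist_map i x y := by
    rw [Subtype.dist_eq, dist_add_right, dist_smul₀, Subtype.dist_eq]
    norm_num

theorem quarterIFS_map_apply_zero (i : Fin 4) (x : unitCube (m + 1)) :
    ((quarterIFS m).map i x).1 0 = 1 / 16 * x.1 0 + (i : ℕ) / 4 := by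
  simp [quarterIFS]

/-- The first coordinates fill intervals of length `1/16` starting at multiples of `1/4`, so the
gaps are at least `3/16`. -/
theorem lt_dist_quarterIFS_map {i j : Fin 4} (hij : i ≠ j) (x y : unitCube (m + 1)) :
    1 / 16 < dist ((quarterIFS m).map i x) ((quarterIFS m).map j y) := by
  refine lt_of_lt_of_le ?_ (abs_sub_apply_le_dist _ _ 0)
  rw [quarterIFS_map_apply_zero, quarterIFS_map_apply_zero]
  obtain ⟨hx0, hx1⟩ := x.2 0
  obtain ⟨hy0, hy1⟩ := y.2 0
  rcases lt_or_gt_of_ne (Fin.val_ne_of_ne hij) with h | h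
  · have h' : ((i : ℕ) : ℝ) + 1 ≤ (j : ℕ) := by exact_mod_cast h
    rw [lt_abs]
    right
    linarith
  · have h' : ((j : ℕ) : ℝ) + 1 ≤ (i : ℕ) := by exact_mod_cast h
    rw [lt_abs]
    left
    linarith

theorem disjoint_quarterIFS_image {i j : Fin 4} (hij : i ≠ j) (A B : Set (unitCube (m + 1))) :
    Disjoint ((quarterIFS m).map i '' A) ((quarterIFS m).map j '' B) := by
  refine Set.disjoint_left.2 ?_
  rintro _ ⟨x, -, rfl⟩ ⟨y, -, h⟩
  have := lt_dist_quarterIFS_map hij x y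
  rw [h, dist_self] at this
  norm_num at this

theorem quarterIFS_isSimilarityDim : (quarterIFS m).IsSimilarityDim (1 / 2) := by
  have h : (1 / 16 : ℝ) ^ (1 / 2 : ℝ) = 1 / 4 := by
    rw [← Real.sqrt_eq_rpow, Real.sqrt_eq_iff_mul_self_eq (by norm_num) (by norm_num)]
    norm_num
  simp only [SimilarityIFS.IsSimilarityDim, quarterIFS, h]
  simp

/-- The whole cube serves as open set, since even its images are disjoint. -/
theorem quarterIFS_cosc {F C : Set (unitCube (m + 1))} (hF : F.Nonempty) :
    (quarterIFS m).COSC F C :=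
  ⟨univ, ⟨isOpen_univ, by simpa using hF, fun _ => subset_univ _,
    fun _ _ hij => disjoint_quarterIFS_image hij _ _⟩, by simp⟩

/-- With a fixed point of one map as condensation set, the condensation term is redundant. -/
theorem exists_quarterIFS_isAttractor : ∃ F, (quarterIFS m).IsAttractor ∅ F := by
  have hfix : (quarterIFS m).map 0 (axisPoint m 0) = axisPoint m 0 := by
    refine Subtype.ext ?_
    ext j
    simp [quarterIFS, axisPoint]
  have h := (quarterIFS m).isAttractor_closure_copies (isCompact_singleton (x := axisPoint m 0))
    (singleton_nonempty _)
  refine ⟨_, h.1, h.2.1, ?_⟩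
  conv_lhs => rw [h.2.2]
  rw [union_empty]
  refine union_eq_left.2 (singleton_subset_iff.2 (mem_iUnion.2 ⟨0, axisPoint m 0, ?_, hfix⟩))
  exact h.condensation_subset rfl

theorem quarterIFS_coverNum_le {C F : Set (unitCube (m + 1))} (h : (quarterIFS m).IsAttractor C F)
    (n : ℕ) : coverNum ((16 : ℝ) ^ (n + 1))⁻¹ F ≤
      4 * coverNum ((16 : ℝ) ^ n)⁻¹ F + coverNum ((16 : ℝ) ^ (n + 1))⁻¹ C := by
  refine (h.coverNum_le (by positivity)).trans (le_of_eq ?_)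
  have : ((16 : ℝ) ^ (n + 1))⁻¹ / (1 / 16) = ((16 : ℝ) ^ n)⁻¹ := by
    rw [pow_succ]
    field_simp
  simp only [quarterIFS, this, Finset.sum_const, Finset.card_univ, Fintype.card_fin, smul_eq_mul]

/-- At scales up to `1/16` the four pieces are covered separately, each like `F` at a scale `16`
times coarser. -/
theorem quarterIFS_le_coverNum {C F : Set (unitCube (m + 1))} (h : (quarterIFS m).IsAttractor C F)
    (n : ℕ) : ∀ δ : ℝ, 0 < δ → δ * 16 ^ n ≤ 1 →
      4 ^ n * coverNum (δ * 16 ^ n) F ≤ coverNum δ F := by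
  induction n with
  | zero => simp
  | succ n ih =>
    intro δ h0 h1
    have hδ : δ ≤ 1 / 16 := by
      rw [pow_succ] at h1
      have : (1 : ℝ) ≤ 16 ^ n := one_le_pow₀ (by norm_num)
      nlinarith
    have h2 := ih (δ * 16) (by positivity) (by rw [pow_succ] at h1; linarith)
    have h3 : ∀ i, coverNum (δ * 16) F ≤ coverNum δ ((quarterIFS m).map i '' F) := fun i => by
      have := coverNum_le_image (by norm_num : (0 : ℝ) < 1 / 16) h0
        (fun x y => ((quarterIFS m).dist_map i x y).ge) F
      rwa [div_div_eq_mul_div, div_one] at this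
    have h4 := sum_coverNum_le h0 h.image_subset (by
      rintro i j hij _ ⟨x, -, rfl⟩ _ ⟨y, -, rfl⟩
      exact hδ.trans_lt (lt_dist_quarterIFS_map hij x y))
    have h5 : 4 * coverNum (δ * 16) F ≤ coverNum δ F := by
      refine le_trans ?_ h4
      refine le_trans (le_of_eq ?_) (Finset.sum_le_sum fun i _ => h3 i)
      simp
    rw [show δ * 16 ^ (n + 1) = δ * 16 * 16 ^ n by ring]
    calc 4 ^ (n + 1) * coverNum (δ * 16 * 16 ^ n) F
        = 4 * (4 ^ n * coverNum (δ * 16 * 16 ^ n) F) := by ring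
      _ ≤ 4 * coverNum (δ * 16) F := Nat.mul_le_mul_left 4 h2
      _ ≤ _ := h5

end Cube

/-! ### A countable compact set of reals with prescribed peaks. -/

section Grids

/-- The first `k` multiples of `16⁻ⁿ`. -/
def grid (n k : ℕ) : Set ℝ := {t | ∃ j < k, t = (j : ℝ) / 16 ^ n}

theorem grid_mono (n : ℕ) {k l : ℕ} (h : k ≤ l) : grid n k ⊆ grid n l :=
  fun _ ⟨j, hj, ht⟩ => ⟨j, hj.trans_le h, ht⟩

theorem finite_grid (n k : ℕ) : (grid n k).Finite :=
  ((finite_lt_nat k).image fun j : ℕ => (j : ℝ) / 16 ^ n).subset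
    fun _ ⟨j, hj, ht⟩ => ⟨j, hj, ht.symm⟩

theorem grid_subset_Icc (n a b k : ℕ) (hab : a * b = 16) (hk : k ≤ a ^ n) :
    grid n k ⊆ Icc 0 (1 / (b : ℝ) ^ n) := by
  rintro _ ⟨j, hj, rfl⟩
  have hb : (0 : ℝ) < b := by
    have : b ≠ 0 := by rintro rfl; simp at hab
    positivity
  refine ⟨by positivity, ?_⟩
  rw [div_le_div_iff₀ (by positivity) (by positivity), one_mul]
  have h1 : j * b ^ n ≤ 16 ^ n := by
    rw [← hab, mul_pow]
    exact Nat.mul_le_mul_right _ (hj.le.trans hk)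
  exact_mod_cast h1

/-- The points contributed at scale `16⁻ⁿ`: always a grid of `4 ^ n` points when `n ≥ 4`, and a
grid of `8 ^ n` points when `n ∈ M`. -/
def gridLevel (M : Set ℕ) (n : ℕ) : Set ℝ :=
  {t | (4 ≤ n ∧ t ∈ grid n (4 ^ n)) ∨ (n ∈ M ∧ t ∈ grid n (8 ^ n))}

variable {M : Set ℕ}

theorem gridLevel_subset (n : ℕ) : gridLevel M n ⊆ grid n (8 ^ n) := by
  rintro t (⟨-, h⟩ | ⟨-, h⟩)
  · exact grid_mono n (Nat.pow_le_pow_left (by norm_num) n) h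
  · exact h

theorem gridLevel_subset_Icc (n : ℕ) : gridLevel M n ⊆ Icc 0 (1 / (2 : ℝ) ^ n) :=
  (gridLevel_subset n).trans (by exact_mod_cast grid_subset_Icc n 8 2 _ (by norm_num) le_rfl)

theorem finite_gridLevel (n : ℕ) : (gridLevel M n).Finite :=
  (finite_grid _ _).subset (gridLevel_subset n)

/-- The countable compact set formed by all grid levels. -/
def gridSet (M : Set ℕ) : Set ℝ := ⋃ n, gridLevel M n

theorem zero_mem_gridSet : (0 : ℝ) ∈ gridSet M :=
  mem_iUnion.2 ⟨4, Or.inl ⟨le_rfl, 0, by norm_num, by simp⟩⟩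

theorem gridSet_subset_Icc (hM : ∀ n ∈ M, 4 ≤ n) : gridSet M ⊆ Icc 0 (1 / 16) := by
  refine iUnion_subset fun n t ht => ?_
  have hn : 4 ≤ n := by
    rcases ht with ht | ht
    · exact ht.1
    · exact hM n ht.1
  obtain ⟨h0, h1⟩ := gridLevel_subset_Icc n ht
  refine ⟨h0, h1.trans ?_⟩
  have : (2 : ℝ) ^ 4 ≤ 2 ^ n := pow_le_pow_right₀ (by norm_num) hn
  rw [div_le_div_iff₀ (by positivity) (by norm_num)]
  linarith

theorem countable_gridSet : (gridSet M).Countable :=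
  countable_iUnion fun n => (finite_gridLevel n).countable

/-- The levels are finite and shrink to `0`, so they accumulate at most at `0`, which belongs to the
set. -/
theorem isClosed_gridSet : IsClosed (gridSet M) := by
  have h : gridSet M =
      ⋂ n : ℕ, ((⋃ k : Fin n, gridLevel M k) ∪ Icc 0 (1 / (2 : ℝ) ^ n)) := by
    refine Subset.antisymm (subset_iInter fun n t ht => ?_) fun t ht => ?_
    · obtain ⟨k, hk⟩ := mem_iUnion.1 ht
      rcases lt_or_ge k n with hkn | hkn
      · exact Or.inl (mem_iUnion.2 ⟨⟨k, hkn⟩, hk⟩)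
      · obtain ⟨h0, h1⟩ := gridLevel_subset_Icc k hk
        refine Or.inr ⟨h0, h1.trans ?_⟩
        exact one_div_le_one_div_of_le (by positivity) (pow_le_pow_right₀ (by norm_num) hkn)
    · by_contra hcon
      have hI : ∀ n : ℕ, t ∈ Icc 0 (1 / (2 : ℝ) ^ n) := fun n => by
        refine (mem_iInter.1 ht n).resolve_left fun h => hcon ?_
        obtain ⟨k, hk⟩ := mem_iUnion.1 h
        exact mem_iUnion.2 ⟨k, hk⟩
      rcases (hI 0).1.eq_or_lt with h0 | h0
      · exact hcon (h0 ▸ zero_mem_gridSet)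
      · obtain ⟨n, hn⟩ := exists_pow_lt_of_lt_one h0 (by norm_num : (1 / 2 : ℝ) < 1)
        have := (hI n).2
        rw [one_div_pow] at hn
        linarith
  rw [h]
  exact isClosed_iInter fun n =>
    (isClosed_iUnion_of_finite fun k => (finite_gridLevel _).isClosed).union isClosed_Icc

theorem isCompact_gridSet (hM : ∀ n ∈ M, 4 ≤ n) : IsCompact (gridSet M) :=
  isCompact_Icc.of_isClosed_subset isClosed_gridSet (gridSet_subset_Icc hM)

end Grids

/-! ### The condensation set and its box dimensions. -/

section GridCondensation

variable {m : ℕ} {M : Set ℕ}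

/-- A point of the first axis, between the images of the first two maps of `quarterIFS`. -/
noncomputable def gapPoint (m : ℕ) (t : ℝ) : unitCube (m + 1) := axisPoint m (1 / 8 + t)

theorem gapPoint_apply_zero {t : ℝ} (ht : t ∈ Icc (0 : ℝ) (1 / 16)) :
    (gapPoint m t).1 0 = 1 / 8 + t :=
  axisPoint_apply_zero ⟨by linarith [ht.1], by linarith [ht.2]⟩

theorem dist_gapPoint_le (s t : ℝ) : dist (gapPoint m s) (gapPoint m t) ≤ |s - t| :=
  (dist_axisPoint_le _ _).trans (by rw [add_sub_add_left_eq_sub])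

theorem continuous_gapPoint : Continuous (gapPoint m) :=
  (LipschitzWith.of_dist_le_mul (K := 1) fun s t => by
    simpa [Real.dist_eq] using dist_gapPoint_le s t).continuous

theorem coverNum_gapPoint_grid_le (δ : ℝ) (n k : ℕ) :
    coverNum δ (gapPoint m '' grid n k) ≤ k := by
  refine (coverNum_le_card (fun j : Fin k => {gapPoint m ((j : ℕ) / 16 ^ n)})
    (fun j => by simp) ?_).trans (by simp)
  rintro _ ⟨_, ⟨j, hj, rfl⟩, rfl⟩
  exact mem_iUnion.2 ⟨⟨j, hj⟩, rfl⟩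

theorem coverNum_gapPoint_Icc_le {δ L : ℝ} (hδ : 0 < δ) {k : ℕ} (hk : L ≤ k * δ) :
    coverNum δ (gapPoint m '' Icc 0 L) ≤ k + 1 := by
  refine (coverNum_le_card
    (fun j : Fin (k + 1) => gapPoint m '' Icc ((j : ℕ) * δ) (((j : ℕ) + 1) * δ))
    (fun j => ?_) ?_).trans (by simp)
  · refine Metric.ediam_le ?_
    rintro _ ⟨s, hs, rfl⟩ _ ⟨t, ht, rfl⟩
    rw [edist_dist]
    refine ENNReal.ofReal_le_ofReal ((dist_gapPoint_le s t).trans (abs_sub_le_iff.2 ⟨?_, ?_⟩))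
    · linarith [hs.2, ht.1]
    · linarith [ht.2, hs.1]
  · rintro _ ⟨t, ht, rfl⟩
    have h0 : 0 ≤ t / δ := div_nonneg ht.1 hδ.le
    have hfl : ⌊t / δ⌋₊ ≤ k := Nat.floor_le_of_le ((div_le_iff₀ hδ).2 (ht.2.trans hk))
    refine mem_iUnion.2 ⟨⟨⌊t / δ⌋₊, Nat.lt_succ_of_le hfl⟩, t, ⟨?_, ?_⟩, rfl⟩
    · exact (le_div_iff₀ hδ).1 (Nat.floor_le h0)
    · exact (div_le_iff₀ hδ).1 (Nat.lt_floor_add_one _).le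

theorem le_coverNum_gapPoint {δ : ℝ} (hδ : 0 < δ) {n k : ℕ} (hn : δ * 16 ^ n < 1)
    (hk : grid n k ⊆ Icc 0 (1 / 16)) {B : Set (unitCube (m + 1))}
    (hB : gapPoint m '' grid n k ⊆ B) : k ≤ coverNum δ B := by
  have hmem : ∀ j : Fin k, ((j : ℕ) : ℝ) / 16 ^ n ∈ grid n k := fun j => ⟨j, j.2, rfl⟩
  have := card_le_coverNum hδ (B := B) (fun j : Fin k => gapPoint m ((j : ℕ) / 16 ^ n))
    (fun j => hB (mem_image_of_mem _ (hmem j))) (fun i j hij => by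
      refine lt_of_lt_of_le ?_ (abs_sub_apply_le_dist _ _ 0)
      rw [gapPoint_apply_zero (hk (hmem i)), gapPoint_apply_zero (hk (hmem j)),
        add_sub_add_left_eq_sub, ← sub_div, abs_div, abs_of_pos (by positivity : (0 : ℝ) < 16 ^ n),
        lt_div_iff₀ (by positivity)]
      refine hn.trans_le ?_
      have : ((i : ℕ) : ℤ) - (j : ℕ) ≠ 0 := sub_ne_zero.2 (by exact_mod_cast Fin.val_ne_of_ne hij)
      have h : ((1 : ℤ) : ℝ) ≤ ((|((i : ℕ) : ℤ) - (j : ℕ)| : ℤ) : ℝ) :=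
        Int.cast_le.2 (Int.one_le_abs this)
      push_cast at h
      exact h)
  simpa using this

/-- The countable condensation set in the gap between the first two images. -/
noncomputable def gridCondensation (m : ℕ) (M : Set ℕ) : Set (unitCube (m + 1)) :=
  gapPoint m '' gridSet M

theorem gridCondensation_nonempty : (gridCondensation m M).Nonempty :=
  ⟨_, mem_image_of_mem _ zero_mem_gridSet⟩

theorem isCompact_gridCondensation (hM : ∀ n ∈ M, 4 ≤ n) : IsCompact (gridCondensation m M) :=
  (isCompact_gridSet hM).image continuous_gapPoint

theorem countable_gridCondensation : (gridCondensation m M).Countable :=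
  countable_gridSet.image _

/-- First coordinates on `C` lie in `[1/8, 3/16]`, between the images in `[0, 1/16]` and `[1/4,
5/16]`. -/
theorem quarterIFS_disjointPieces (hM : ∀ n ∈ M, 4 ≤ n) (F : Set (unitCube (m + 1))) :
    (quarterIFS m).DisjointPieces (gridCondensation m M) F := by
  refine ⟨fun i j hij => disjoint_quarterIFS_image hij _ _, fun i => Set.disjoint_left.2 ?_⟩
  rintro _ ⟨x, -, rfl⟩ ⟨t, ht, h⟩
  have ht := gridSet_subset_Icc hM ht
  have h0 := congrArg (fun y : unitCube (m + 1) => y.1 0) h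
  simp only [gapPoint_apply_zero ht, quarterIFS_map_apply_zero] at h0
  obtain ⟨hx0, hx1⟩ := x.2 0
  obtain ⟨ht0, ht1⟩ := ht
  rcases Nat.eq_zero_or_pos (i : ℕ) with hi | hi
  · rw [hi] at h0
    norm_num at h0
    linarith
  · have : (1 : ℝ) ≤ (i : ℕ) := by exact_mod_cast hi
    linarith

theorem coverNum_iUnion_gapPoint_grid_le {δ : ℝ} (hδ : 0 < δ) (n : ℕ) {b : ℕ} (hb : 2 ≤ b) :
    coverNum δ (⋃ k : Fin n, gapPoint m '' grid k (b ^ (k : ℕ))) ≤ b ^ n := by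
  refine (coverNum_iUnion_le hδ _).trans ((Finset.sum_le_sum fun (k : Fin n) _ =>
    coverNum_gapPoint_grid_le δ (k : ℕ) (b ^ (k : ℕ))).trans ?_)
  rw [Fin.sum_univ_eq_sum_range (fun k => b ^ k)]
  exact (Nat.geomSum_lt hb (by simp)).le

/-- Coarse grids are counted point by point: base grids below level `x`, peaks up to `y`. Fine ones
are covered by intervals: base grids from level `x` on lie in `[0, 4⁻ˣ]`, peaks from `z` on in `[0,
2⁻ᶻ]`. For `z > 4x` the truncated exponent `0` still suffices. -/
theorem coverNum_gridCondensation_le {y z : ℕ} (h : ∀ n ∈ M, n ≤ y ∨ z ≤ n) (x : ℕ) :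
    coverNum ((16 : ℝ) ^ x)⁻¹ (gridCondensation m M) ≤
      2 * 4 ^ x + 8 ^ (y + 1) + 2 ^ (4 * x - z) + 2 := by
  have hδ : 0 < ((16 : ℝ) ^ x)⁻¹ := by positivity
  set δ := ((16 : ℝ) ^ x)⁻¹ with hδdef
  have hsub : gridCondensation m M ⊆
      ((⋃ n : Fin x, gapPoint m '' grid n (4 ^ (n : ℕ))) ∪
        ⋃ n : Fin (y + 1), gapPoint m '' grid n (8 ^ (n : ℕ))) ∪
        (gapPoint m '' Icc 0 (1 / 4 ^ x) ∪ gapPoint m '' Icc 0 (1 / 2 ^ z)) := by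
    rintro _ ⟨t, ht, rfl⟩
    obtain ⟨n, ⟨hn, ht⟩ | ⟨hn, ht⟩⟩ := mem_iUnion.1 ht
    · rcases lt_or_ge n x with hx | hx
      · exact Or.inl (Or.inl (mem_iUnion.2 ⟨⟨n, hx⟩, mem_image_of_mem _ ht⟩))
      · refine Or.inr (Or.inl (mem_image_of_mem _ ?_))
        have h4 := grid_subset_Icc n 4 4 _ (by norm_num) le_rfl ht
        refine ⟨h4.1, h4.2.trans (one_div_le_one_div_of_le (by positivity) ?_)⟩
        exact_mod_cast Nat.pow_le_pow_right (by norm_num) hx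
    · rcases h n hn with hx | hx
      · exact Or.inl (Or.inr (mem_iUnion.2 ⟨⟨n, Nat.lt_succ_of_le hx⟩, mem_image_of_mem _ ht⟩))
      · refine Or.inr (Or.inr (mem_image_of_mem _ ?_))
        have h4 := grid_subset_Icc n 8 2 _ (by norm_num) le_rfl ht
        refine ⟨h4.1, h4.2.trans (one_div_le_one_div_of_le (by positivity) ?_)⟩
        exact_mod_cast Nat.pow_le_pow_right (by norm_num) hx
  have h1 : coverNum δ (⋃ n : Fin x, gapPoint m '' grid n (4 ^ (n : ℕ))) ≤ 4 ^ x :=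
    coverNum_iUnion_gapPoint_grid_le hδ x (by norm_num)
  have h2 : coverNum δ (⋃ n : Fin (y + 1), gapPoint m '' grid n (8 ^ (n : ℕ))) ≤ 8 ^ (y + 1) :=
    coverNum_iUnion_gapPoint_grid_le hδ (y + 1) (by norm_num)
  have h3 : coverNum δ (gapPoint m '' Icc 0 (1 / 4 ^ x)) ≤ 4 ^ x + 1 := by
    refine coverNum_gapPoint_Icc_le hδ ?_
    rw [hδdef, show (16 : ℝ) = 4 * 4 by norm_num, mul_pow]
    push_cast
    field_simp
    exact le_rfl
  have h4 : coverNum δ (gapPoint m '' Icc 0 (1 / 2 ^ z)) ≤ 2 ^ (4 * x - z) + 1 := by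
    refine coverNum_gapPoint_Icc_le hδ ?_
    rw [hδdef, ← div_eq_mul_inv, div_le_div_iff₀ (by positivity) (by positivity), one_mul]
    push_cast
    rw [← pow_add, show (16 : ℝ) = 2 ^ 4 by norm_num, ← pow_mul]
    exact pow_le_pow_right₀ (by norm_num) (by omega)
  have := ((coverNum_mono hδ le_rfl hsub).trans (coverNum_union_le hδ _ _)).trans
    (Nat.add_le_add (coverNum_union_le hδ _ _) (coverNum_union_le hδ _ _))
  omega

theorem le_coverNum_gridCondensation_base (hM : ∀ n ∈ M, 4 ≤ n) {n : ℕ} (hn : 4 ≤ n) {δ : ℝ}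
    (hδ : 0 < δ) (h : δ * 16 ^ n < 1) : 4 ^ n ≤ coverNum δ (gridCondensation m M) := by
  have hsub : grid n (4 ^ n) ⊆ gridSet M := fun t ht => mem_iUnion.2 ⟨n, Or.inl ⟨hn, ht⟩⟩
  exact le_coverNum_gapPoint hδ h (hsub.trans (gridSet_subset_Icc hM)) (image_mono hsub)

theorem le_coverNum_gridCondensation (hM : ∀ n ∈ M, 4 ≤ n) {n : ℕ} (hn : n ∈ M) {δ : ℝ}
    (hδ : 0 < δ) (h : δ * 16 ^ n < 1) : 8 ^ n ≤ coverNum δ (gridCondensation m M) := by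
  have hsub : grid n (8 ^ n) ⊆ gridSet M := fun t ht => mem_iUnion.2 ⟨n, Or.inr ⟨hn, ht⟩⟩
  exact le_coverNum_gapPoint hδ h (hsub.trans (gridSet_subset_Icc hM)) (image_mono hsub)

theorem sixteen_pow_rpow (n : ℕ) (t : ℝ) : ((16 : ℝ) ^ n) ^ t = 2 ^ (4 * t * n) := by
  rw [show (16 : ℝ) = 2 ^ (4 : ℝ) by norm_num, ← Real.rpow_natCast, ← Real.rpow_mul (by norm_num),
    ← Real.rpow_mul (by norm_num)]
  ring_nf

theorem sixteen_pow_rpow_le {n k : ℕ} {t : ℝ} (h : 4 * t * n ≤ k) :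
    ((16 : ℝ) ^ n) ^ t ≤ 2 ^ k := by
  rw [sixteen_pow_rpow, ← Real.rpow_natCast 2 k]
  exact Real.rpow_le_rpow_of_exponent_le one_le_two h

theorem le_sixteen_pow_rpow {n k : ℕ} {t : ℝ} (h : k ≤ 4 * t * n) :
    (2 : ℝ) ^ k ≤ ((16 : ℝ) ^ n) ^ t := by
  rw [sixteen_pow_rpow, ← Real.rpow_natCast 2 k]
  exact Real.rpow_le_rpow_of_exponent_le one_le_two h

theorem frequently_of_sixteen_pow {P : ℝ → Prop} (h : ∀ n₀ : ℕ, ∃ n ≥ n₀, P ((16 : ℝ) ^ n)⁻¹) :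
    ∃ᶠ δ : ℝ in 𝓝[>] 0, P δ := by
  have hlim : Tendsto (fun n : ℕ => ((16 : ℝ) ^ n)⁻¹) atTop (𝓝[>] 0) :=
    tendsto_inv_atTop_nhdsGT_zero.comp (tendsto_pow_atTop_atTop_of_one_lt (by norm_num))
  exact hlim.frequently (frequently_atTop.2 h)

theorem sixteen_pow_inv_rpow_neg (n : ℕ) (t : ℝ) :
    (((16 : ℝ) ^ n)⁻¹) ^ (-t) = ((16 : ℝ) ^ n) ^ t := by
  rw [Real.rpow_neg (by positivity), Real.inv_rpow (by positivity), inv_inv]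

theorem upperBoxDim_gridCondensation (hM : ∀ n ∈ M, 4 ≤ n) (hinf : ∀ n₀, ∃ n ∈ M, n₀ ≤ n) :
    upperBoxDim (gridCondensation m M) = ENNReal.ofReal (3 / 4) := by
  refine le_antisymm ?_ ?_
  · refine upperBoxDim_le_of_pow (b := 16) (K := 13) (by norm_num) (by norm_num) (by norm_num)
      fun n => ?_
    have h1 : (8 : ℝ) ^ n ≤ ((16 : ℝ) ^ n) ^ (3 / 4 : ℝ) := by
      rw [show (8 : ℝ) = 2 ^ 3 by norm_num, ← pow_mul]
      refine le_sixteen_pow_rpow (le_of_eq ?_)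
      push_cast
      ring
    refine le_trans ?_ (mul_le_mul_of_nonneg_left h1 (by norm_num))
    -- Choosing `y = z = n` needs no gap in `M`; then `13 = 2 + 8 + 1 + 2`.
    have h2 := coverNum_gridCondensation_le (m := m) (M := M) (y := n) (z := n)
      (fun k _ => le_total k n) n
    have h3 : 4 ^ n ≤ 8 ^ n := Nat.pow_le_pow_left (by norm_num) n
    have h4 : 2 ^ (4 * n - n) = 8 ^ n := by
      rw [show 4 * n - n = 3 * n by omega, pow_mul]
      norm_num
    have h5 : 1 ≤ 8 ^ n := Nat.one_le_pow _ _ (by norm_num)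
    have h6 : 8 ^ (n + 1) = 8 * 8 ^ n := by ring
    have h7 : coverNum ((16 : ℝ) ^ n)⁻¹ (gridCondensation m M) ≤ 13 * 8 ^ n := by omega
    exact_mod_cast h7
  · refine le_upperBoxDim (K := 1 / 8) (by norm_num) (frequently_of_sixteen_pow fun n₀ => ?_)
    obtain ⟨n, hn, hn0⟩ := hinf n₀
    -- Points at distance exactly `16⁻ⁿ` need a strictly smaller scale; the extra level accounts for
    -- `K = 1 / 8`.
    refine ⟨n + 1, by omega, ?_⟩
    have h1 : 8 ^ n ≤ coverNum ((16 : ℝ) ^ (n + 1))⁻¹ (gridCondensation m M) :=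
      le_coverNum_gridCondensation hM hn (by positivity) (by
        rw [inv_mul_lt_one₀ (by positivity)]
        exact pow_lt_pow_right₀ (by norm_num) n.lt_succ_self)
    rw [sixteen_pow_inv_rpow_neg]
    have h2 : ((16 : ℝ) ^ (n + 1)) ^ (3 / 4 : ℝ) ≤ 8 ^ (n + 1) := by
      rw [show (8 : ℝ) = 2 ^ 3 by norm_num, ← pow_mul]
      refine sixteen_pow_rpow_le (le_of_eq ?_)
      push_cast
      ring
    have h1' : (8 : ℝ) ^ n ≤ coverNum ((16 : ℝ) ^ (n + 1))⁻¹ (gridCondensation m M) := by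
      exact_mod_cast h1
    rw [pow_succ 8 n] at h2
    linarith

/-- The conditions on `x` say that neither the last peak (`8^y ≤ 4^x`) nor the next one (`2^(4x-z) ≤
4^x`) outweighs the base grids, which alone give the lower bound. -/
theorem lowerBoxDim_gridCondensation (hM : ∀ n ∈ M, 4 ≤ n)
    (hgap : ∀ n₀ : ℕ, ∃ x ≥ n₀, ∃ y z : ℕ, (∀ n ∈ M, n ≤ y ∨ z ≤ n) ∧ 3 * y ≤ 2 * x ∧ 2 * x ≤ z) :
    lowerBoxDim (gridCondensation m M) = ENNReal.ofReal (1 / 2) := by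
  refine le_antisymm ?_ ?_
  · refine lowerBoxDim_le (K := 13) (by norm_num) (frequently_of_sixteen_pow fun n₀ => ?_)
    obtain ⟨x, hx, y, z, h, hy, hz⟩ := hgap n₀
    refine ⟨x, hx, ?_⟩
    have h1 : (4 : ℝ) ^ x ≤ ((16 : ℝ) ^ x) ^ (1 / 2 : ℝ) := by
      rw [show (4 : ℝ) = 2 ^ 2 by norm_num, ← pow_mul]
      refine le_sixteen_pow_rpow (le_of_eq ?_)
      push_cast
      ring
    rw [sixteen_pow_inv_rpow_neg]
    refine le_trans ?_ (mul_le_mul_of_nonneg_left h1 (by norm_num))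
    have h2 := coverNum_gridCondensation_le (m := m) h x
    have h3 : 8 ^ y ≤ 4 ^ x := by
      rw [show 8 = 2 ^ 3 by norm_num, show 4 = 2 ^ 2 by norm_num, ← pow_mul, ← pow_mul]
      exact Nat.pow_le_pow_right (by norm_num) hy
    have h4 : 2 ^ (4 * x - z) ≤ 4 ^ x := by
      rw [show 4 ^ x = 2 ^ (2 * x) by rw [pow_mul]; norm_num]
      exact Nat.pow_le_pow_right (by norm_num) (by omega)
    have h5 : 1 ≤ 4 ^ x := Nat.one_le_pow _ _ (by norm_num)
    have h6 : 8 ^ (y + 1) = 8 * 8 ^ y := by ring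
    have h7 : coverNum ((16 : ℝ) ^ x)⁻¹ (gridCondensation m M) ≤ 13 * 4 ^ x := by omega
    exact_mod_cast h7
  · refine le_lowerBoxDim_of_pow (b := 16) (K := 1) (n₀ := 4) (by norm_num) one_pos (by norm_num)
      fun n hn δ h0 h1 => ?_
    have h2 : ((16 : ℝ) ^ n) ^ (1 / 2 : ℝ) ≤ 4 ^ n := by
      rw [show (4 : ℝ) = 2 ^ 2 by norm_num, ← pow_mul]
      refine sixteen_pow_rpow_le (le_of_eq ?_)
      push_cast
      ring
    rw [one_mul]
    refine h2.trans ?_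
    exact_mod_cast le_coverNum_gridCondensation_base hM hn h0 h1

end GridCondensation

/-! ### Lower box dimension of `F_C` for dense and for sparse peaks. -/

section Comparison

variable {m : ℕ}

/-- The positive powers of `R`. -/
def posPowers (R : ℕ) : Set ℕ := range fun k : ℕ => R ^ (k + 1)

theorem four_le_of_mem_posPowers {R : ℕ} (hR : 4 ≤ R) : ∀ n ∈ posPowers R, 4 ≤ n := by
  rintro _ ⟨k, rfl⟩
  exact hR.trans (Nat.le_self_pow k.succ_ne_zero R)

theorem le_or_le_of_mem_posPowers {R : ℕ} (hR : 4 ≤ R) (k : ℕ) :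
    ∀ n ∈ posPowers R, n ≤ R ^ (k + 1) ∨ R * R ^ (k + 1) ≤ n := by
  rintro _ ⟨j, rfl⟩
  rcases le_or_gt j k with h | h
  · exact Or.inl (Nat.pow_le_pow_right (by omega) (by omega))
  · right
    rw [← pow_succ']
    exact Nat.pow_le_pow_right (by omega) (by omega)

theorem lt_pow_succ {R : ℕ} (hR : 4 ≤ R) (n : ℕ) : n < R ^ (n + 1) :=
  (Nat.lt_succ_self n).trans (Nat.lt_pow_self (by omega))

theorem upperBoxDim_gridCondensation_posPowers {R : ℕ} (hR : 4 ≤ R) :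
    upperBoxDim (gridCondensation m (posPowers R)) = ENNReal.ofReal (3 / 4) :=
  upperBoxDim_gridCondensation (four_le_of_mem_posPowers hR) fun n₀ =>
    ⟨R ^ (n₀ + 1), ⟨n₀, rfl⟩, (lt_pow_succ hR n₀).le⟩

theorem lowerBoxDim_gridCondensation_posPowers {R : ℕ} (hR : 4 ≤ R) :
    lowerBoxDim (gridCondensation m (posPowers R)) = ENNReal.ofReal (1 / 2) := by
  -- At `x = 2y` the conditions read `3y ≤ 4y ≤ R y`.
  refine lowerBoxDim_gridCondensation (four_le_of_mem_posPowers hR) fun n₀ =>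
    ⟨2 * R ^ (n₀ + 1), ?_, R ^ (n₀ + 1), R * R ^ (n₀ + 1), le_or_le_of_mem_posPowers hR n₀, ?_, ?_⟩
  · have := lt_pow_succ hR n₀
    omega
  · omega
  · nlinarith [Nat.mul_le_mul_right (R ^ (n₀ + 1)) hR]

/-- The last peak `y ≤ x` has `x < 4y`, and its `4^(x-y)` copies force `2^(2x+y)` covering sets,
where `(2x + y) / (4x) ≥ 9/16`. -/
theorem le_lowerBoxDim_quarterIFS {F : Set (unitCube (m + 1))}
    (h : (quarterIFS m).IsAttractor (gridCondensation m (posPowers 4)) F) :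
    ENNReal.ofReal (9 / 16) ≤ lowerBoxDim F := by
  refine le_lowerBoxDim_of_pow (b := 16) (K := 1) (n₀ := 4) (by norm_num) one_pos (by norm_num)
    fun x hx δ h0 h1 => ?_
  obtain ⟨k, hk⟩ : ∃ k, Nat.log 4 x = k + 1 :=
    Nat.exists_eq_succ_of_ne_zero (Nat.log_pos (by norm_num) hx).ne'
  have hkx : 4 ^ (k + 1) ≤ x := by
    rw [← hk]
    exact Nat.pow_log_le_self 4 (by omega)
  have hxk : x < 4 * 4 ^ (k + 1) := by
    rw [← pow_succ', ← hk]
    exact Nat.lt_pow_succ_log_self (by norm_num) x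
  set y := 4 ^ (k + 1) with hy
  have hpow : δ * 16 ^ (x - y) * 16 ^ y = δ * 16 ^ x := by
    rw [mul_assoc, ← pow_add, Nat.sub_add_cancel hkx]
  have hle : δ * 16 ^ (x - y) ≤ 1 := by
    have : (1 : ℝ) ≤ 16 ^ y := one_le_pow₀ (by norm_num)
    have : 0 < δ * 16 ^ (x - y) := by positivity
    nlinarith
  have h2 := quarterIFS_le_coverNum h (x - y) δ h0 hle
  have h3 : 8 ^ y ≤ coverNum (δ * 16 ^ (x - y)) F :=
    (le_coverNum_gridCondensation (four_le_of_mem_posPowers le_rfl) ⟨k, rfl⟩ (by positivity)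
      (by rwa [hpow])).trans (coverNum_mono (by positivity) le_rfl h.condensation_subset)
  have h4 : 2 ^ (2 * x + y) ≤ coverNum δ F := by
    refine le_trans (le_of_eq ?_) ((Nat.mul_le_mul_left _ h3).trans h2)
    rw [show 8 = 2 ^ 3 by norm_num, show 4 = 2 ^ 2 by norm_num, ← pow_mul, ← pow_mul, ← pow_add]
    congr 1
    omega
  rw [one_mul]
  refine (sixteen_pow_rpow_le (k := 2 * x + y) ?_).trans (by exact_mod_cast h4)
  have : (x : ℝ) ≤ 4 * y := by exact_mod_cast hxk.le
  push_cast
  linarith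

/-- The renewal inequality is unrolled from scale `1` down to level `x = 32y`, halfway to the next
peak `64y`. -/
theorem lowerBoxDim_quarterIFS_le {F : Set (unitCube (m + 1))}
    (h : (quarterIFS m).IsAttractor (gridCondensation m (posPowers 64)) F) :
    lowerBoxDim F ≤ ENNReal.ofReal (35 / 64) := by
  set K₀ := coverNum ((16 : ℝ) ^ 0)⁻¹ F with hK₀
  refine lowerBoxDim_le (K := K₀ + 13 * 32) (by norm_num) (frequently_of_sixteen_pow fun n₀ => ?_)
  set y := 64 ^ (n₀ + 1) with hy
  have hy0 : n₀ < y := lt_pow_succ (by norm_num) n₀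
  -- Up to level `32y` the next peak costs at most `2^(4x-64y) ≤ 4^x`; the product form is crude but
  -- uniform in `x`.
  have hC : ∀ x ≤ 32 * y,
      coverNum ((16 : ℝ) ^ x)⁻¹ (gridCondensation m (posPowers 64)) ≤ 4 ^ x * (13 * 8 ^ y) := by
    intro x hx
    have h1 := coverNum_gridCondensation_le (m := m)
      (le_or_le_of_mem_posPowers (by norm_num) n₀ : ∀ n ∈ posPowers 64, _) x
    rw [← hy] at h1
    have h2 : 2 ^ (4 * x - 64 * y) ≤ 4 ^ x := by
      rw [show 4 ^ x = 2 ^ (2 * x) by rw [pow_mul]; norm_num]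
      exact Nat.pow_le_pow_right (by norm_num) (by omega)
    have h3 : 1 ≤ 4 ^ x := Nat.one_le_pow _ _ (by norm_num)
    have h4 : 1 ≤ 8 ^ y := Nat.one_le_pow _ _ (by norm_num)
    have h5 : 8 ^ (y + 1) = 8 * 8 ^ y := by ring
    nlinarith [Nat.mul_le_mul h3 h4, Nat.mul_le_mul_left (4 ^ x) h4,
      Nat.mul_le_mul_right (8 ^ y) h3]
  have key : ∀ x ≤ 32 * y, coverNum ((16 : ℝ) ^ x)⁻¹ F ≤ 4 ^ x * (K₀ + 13 * 8 ^ y * x) := by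
    intro x
    induction x with
    | zero => intro _; simp [hK₀]
    | succ x ih =>
      intro hx
      have h1 := ih (by omega)
      have h2 := hC (x + 1) hx
      have h3 := quarterIFS_coverNum_le h x
      calc _ ≤ 4 * (4 ^ x * (K₀ + 13 * 8 ^ y * x)) + 4 ^ (x + 1) * (13 * 8 ^ y) := by omega
        _ = _ := by ring
  refine ⟨32 * y, by omega, ?_⟩
  have h1 : coverNum ((16 : ℝ) ^ (32 * y))⁻¹ F ≤ (K₀ + 13 * 32) * 2 ^ (2 * (32 * y) + 4 * y) := by
    refine (key _ le_rfl).trans ?_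
    -- This absorbs the number `32y` of renewal steps. The exponent becomes `68y / 128y = 34/64`,
    -- still below `35/64`.
    have h2 : y ≤ 2 ^ y := Nat.lt_two_pow_self.le
    have h3 : (2 : ℕ) ^ (2 * (32 * y) + 4 * y) = 4 ^ (32 * y) * (8 ^ y * 2 ^ y) := by
      rw [← mul_pow, pow_add, pow_mul, pow_mul 2 4 y]
      norm_num
    have h4 : 1 ≤ 8 ^ y * 2 ^ y := Nat.one_le_iff_ne_zero.2 (by positivity)
    rw [h3]
    calc 4 ^ (32 * y) * (K₀ + 13 * 8 ^ y * (32 * y))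
        = 4 ^ (32 * y) * (K₀ * 1 + 13 * 32 * (8 ^ y * y)) := by ring
      _ ≤ 4 ^ (32 * y) * (K₀ * (8 ^ y * 2 ^ y) + 13 * 32 * (8 ^ y * 2 ^ y)) := by gcongr
      _ = _ := by ring
  rw [sixteen_pow_inv_rpow_neg]
  have h2 : (2 : ℝ) ^ (2 * (32 * y) + 4 * y) ≤ ((16 : ℝ) ^ (32 * y)) ^ (35 / 64 : ℝ) := by
    refine le_sixteen_pow_rpow ?_
    push_cast
    have : (0 : ℝ) ≤ y := Nat.cast_nonneg _
    linarith
  refine le_trans ?_ (mul_le_mul_of_nonneg_left h2 (by positivity))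
  exact_mod_cast h1

end Comparison

theorem corollary2p12 :
    -- the lower box dimension is not a function of the six numbers, even on the cube `[0,1]^d`
    -- and among the systems that satisfy the separation conditions
    (∀ d : ℕ, 1 ≤ d →
      ¬ ∃ f : ℝ≥0∞ → ℝ≥0∞ → ℝ≥0∞ → ℝ≥0∞ → ℝ≥0∞ → ℝ → ℝ≥0∞,
        ∀ (N : ℕ) (I : SimilarityIFS (unitCube d) N) (C F₀ FC : Set (unitCube d))
          (D : ℝ≥0∞) (s : ℝ),
          C.Nonempty → IsCompact C → I.IsAttractor ∅ F₀ → I.IsAttractor C FC →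
          I.COSC F₀ C → I.DisjointPieces C FC →
          HasBoxDim F₀ D → I.IsSimilarityDim s →
          lowerBoxDim FC =
            f (lowerBoxDim C) (upperBoxDim C) (dimH C) (packingDim C) D s) ∧
    -- the contrast: Hausdorff, packing and all countably stable dimensions without any separation
    -- condition, and upper box dimension under the strong open set condition
    (∀ (X : Type*) [MetricSpace X] [CompactSpace X] (N : ℕ) (I : SimilarityIFS X N)
      (C F₀ FC : Set X),
      C.Nonempty → IsCompact C → I.IsAttractor ∅ F₀ → I.IsAttractor C FC →
      dimH FC = max (dimH F₀) (dimH C) ∧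
      packingDim FC = max (packingDim F₀) (packingDim C) ∧
      (∀ dim : Set X → ℝ≥0∞, IsCountablyStable dim →
        (∀ i A, dim (I.map i '' A) = dim A) → dim FC = max (dim F₀) (dim C)) ∧
      (I.SOSC F₀ → upperBoxDim FC = max (upperBoxDim F₀) (upperBoxDim C))) := by
  refine ⟨?_, fun X _ _ N I C F₀ FC _ _ h₀ h => ⟨?_, ?_, fun dim => h₀.dim_eq_max h,
    fun hS => hS.upperBoxDim_eq_max h₀ h⟩⟩
  · rintro d hd ⟨f, hf⟩
    obtain ⟨m, rfl⟩ : ∃ m, d = m + 1 := ⟨d - 1, by omega⟩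
    obtain ⟨F₀, h₀⟩ := exists_quarterIFS_isAttractor (m := m)
    have hS : (quarterIFS m).SOSC F₀ :=
      let ⟨U, hU, _⟩ := quarterIFS_cosc (C := ∅) h₀.1
      ⟨U, hU⟩
    -- All six arguments of `f` are independent of `R`.
    have key : ∀ R, 4 ≤ R → ∃ F,
        (quarterIFS m).IsAttractor (gridCondensation m (posPowers R)) F ∧ lowerBoxDim F =
          f (ENNReal.ofReal (1 / 2)) (ENNReal.ofReal (3 / 4)) 0 0 (lowerBoxDim F₀) (1 / 2) := by
      intro R hR
      have hM := four_le_of_mem_posPowers hR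
      have hC := isCompact_gridCondensation (m := m) hM
      have hF := (quarterIFS m).isAttractor_closure_copies hC gridCondensation_nonempty
      refine ⟨_, hF, ?_⟩
      rw [hf 4 (quarterIFS m) _ F₀ _ _ (1 / 2) gridCondensation_nonempty hC h₀ hF
        (quarterIFS_cosc h₀.1) (quarterIFS_disjointPieces hM _) (hS.hasBoxDim h₀)
        quarterIFS_isSimilarityDim, lowerBoxDim_gridCondensation_posPowers hR,
        upperBoxDim_gridCondensation_posPowers hR, countable_gridCondensation.dimH_zero,
        packingDim_of_countable countable_gridCondensation]
    obtain ⟨F, hF, h1⟩ := key 4 le_rfl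
    obtain ⟨G, hG, h2⟩ := key 64 (by norm_num)
    -- This would give `36/64 ≤ 35/64`.
    have h3 := (le_lowerBoxDim_quarterIFS hF).trans
      ((h1.trans h2.symm).le.trans (lowerBoxDim_quarterIFS_le hG))
    rw [ENNReal.ofReal_le_ofReal_iff (by norm_num)] at h3
    norm_num at h3
  · exact h₀.dim_eq_max h isCountablyStable_dimH fun i A =>
      dimH_image_of_dist (I.ratio_pos i) (I.dist_map i) A
  · exact h₀.dim_eq_max h isCountablyStable_packingDim fun i A =>
      packingDim_image (I.ratio_pos i) (I.dist_map i) A
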